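/- Let $(X,\|\cdot\|)$ be a Banach space over $\mathbb{R}$ or $\mathbb{C}$ with norm topology $\tau_{\|\cdot\|}$. Definitions. For a Hausdorff locally convex topology $\sigma$ on $X$, a *directed system of continuous seminorms generating $\sigma$* is a non-empty set $\Gamma_\sigma$ of seminorms on $X$ that generates the topology $\sigma$ and is such that for all $p,q\in\Gamma_\sigma$ there are $r\in\Gamma_\sigma$ and $C\ge 0$ with $\max(p,q)\le C\,r$. It is called *norming* if $\|x\|=\sup_{p\in\Gamma_\sigma}p(x)$ for all $x\in X$. Let $\tau\subseteq\tau_{\|\cdot\|}$ be a Hausdorff locally convex topology on $X$. The *mixed topology* $\gamma=\gamma(\|\cdot\|,\tau)$ is the finest linear topology on $X$ with $\tau\subseteq\gamma\subseteq\tau_{\|\cdot\|}$ that coincides with $\tau$ on $\|\cdot\|$-bounded sets. The triple $(X,\|\cdot\|,\tau)$ is a *Saks space* if $\tau$ is generated by some norming directed system of continuous seminorms, and it is *sequentially complete* if $(X,\gamma)$ is sequentially complete. A *$\tau$-bi-continuous contraction semigroup* on $X$ is a family $(T(t))_{t\ge 0}$ of norm-continuous linear operators on $X$ such that 1. $T(0)=\mathrm{id}$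 and $T(t+s)=T(t)T(s)$ for all $t,s\ge 0$; 2. $t\mapsto T(t)x$ is $\tau$-continuous on $[0,\infty)$ for every $x\in X$; 3. $(T(t))_{t\ge0}$ is exponentially bounded, i.e. there are $M\ge 1$ and $\omega\in\mathbb{R}$ with $\|T(t)\|\le Me^{\omega t}$ for all $t\ge 0$; 4. for every $\|\cdot\|$-bounded sequence $(x_n)$ that $\tau$-converges to some $x\in X$, one has $\tau\text{-}\lim_{n\to\infty}T(t)(x_n-x)=0$ uniformly for $t\in[0,t_0]$, for every $t_0\ge 0$; 5. $\|T(t)\|\le 1$ for all $t\ge 0$ (contractivity). Its *generator* is the operator $(A,D(A))$ with $$D(A)=\Bigl\{x\in X: \tau\text{-}\lim_{t\to 0+}\tfrac{T(t)x-x}{t}\text{ exists in }X\text{ and }\sup_{t\in(0,1]}\tfrac{\|T(t)x-x\|}{t}<\infty\Bigr\},\qquad Ax=\tau\text{-}\lim_{t\to 0+}\tfrac{T(t)x-x}{t}.$$ Theorem. Let $(X,\|\cdot\|,\tau)$ be a sequentially complete Saks space, and let $\upsilon$ be a Hausdorff locally convex topology on $X$ with $\tau\subseteq\upsilon\subseteq\tau_{\|\cdot\|}$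 such that every $\gamma$-convergent sequence is $\upsilon$-convergent. Let $\Gamma_\upsilon$ be a norming directed system of continuous seminorms that generates $\upsilon$. Let $A\colon D(A)\subseteq X\to X$ be a linear operator, defined on a linear subspace $D(A)$, that is - *bi-densely defined*: every $x\in X$ is the $\tau$-limit of a $\|\cdot\|$-bounded sequence in $D(A)$; and - *$\Gamma_\upsilon$-dissipative*: $p((\lambda-A)x)\ge\lambda\,p(x)$ for all $\lambda>0$, $x\in D(A)$ and $p\in\Gamma_\upsilon$. Then the following assertions are equivalent: (a) $(A,D(A))$ is the generator of a $\tau$-bi-continuous contraction semigroup on $X$. (b) $\lambda-A\colon D(A)\to X$ is surjective for some $\lambda>0$. -/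

import Mathlib

open Filter Topology NNReal

namespace SaksSpace

section Topologies

variable (𝕜 : Type*) {X : Type*} [RCLike 𝕜] [NormedAddCommGroup X] [NormedSpace 𝕜 X]

/-- The topology `τ_{‖·‖}` induced by the norm. -/
abbrev normTopology (X : Type*) [NormedAddCommGroup X] : TopologicalSpace X :=
  UniformSpace.toTopologicalSpace

/-- `τ` is a Hausdorff locally convex topology on the `𝕜`-vector space `X`, i.e. it is Hausdorff and
generated by its continuous seminorms. -/
structure IsHausdorffLocallyConvex (τ : TopologicalSpace X) : Prop where
  t2 : @T2Space X τ
  polynormable : @PolynormableSpace 𝕜 X _ _ _ τ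

/-- `σ` is a linear (vector space) topology on `X`. -/
structure IsVectorTopology (σ : TopologicalSpace X) : Prop where
  isTopologicalAddGroup : @IsTopologicalAddGroup X σ _
  continuousSMul : @ContinuousSMul 𝕜 X _ _ σ

/-- `σ` coincides with `τ` on `‖·‖`-bounded sets. -/
def AgreeOnBounded (σ τ : TopologicalSpace X) : Prop :=
  ∀ B : Set X, Bornology.IsBounded B →
    TopologicalSpace.induced (Subtype.val : B → X) σ =
      TopologicalSpace.induced (Subtype.val : B → X) τ

/-- The linear topologies `σ` with `τ ⊆ σ ⊆ τ_{‖·‖}` that coincide with `τ` on `‖·‖`-bounded sets.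
(In Mathlib's order on topologies, `σ ≤ τ` means that `σ` is finer than `τ`.) -/
def mixedCandidates (τ : TopologicalSpace X) : Set (TopologicalSpace X) :=
  {σ | IsVectorTopology 𝕜 σ ∧ AgreeOnBounded σ τ ∧ σ ≤ τ ∧ normTopology X ≤ σ}

/-- The mixed topology `γ(‖·‖, τ)`: the finest linear topology `σ` with `τ ⊆ σ ⊆ τ_{‖·‖}` that
coincides with `τ` on `‖·‖`-bounded sets; see `isLeast_mixedTopology`. -/
@[reducible] def mixedTopology (τ : TopologicalSpace X) : TopologicalSpace X :=
  sInf (mixedCandidates 𝕜 τ)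

/-- `Γ` is a directed system of continuous seminorms that generates `τ`. Continuity is
part of `WithSeminorms`. -/
structure IsGeneratingSystem (Γ : Set (Seminorm 𝕜 X)) (τ : TopologicalSpace X) : Prop where
  nonempty : Γ.Nonempty
  directed : ∀ p ∈ Γ, ∀ q ∈ Γ, ∃ r ∈ Γ, ∃ C : ℝ, 0 ≤ C ∧ ∀ x, max (p x) (q x) ≤ C * r x
  withSeminorms : @WithSeminorms 𝕜 X Γ _ _ _ (fun p : Γ => (p : Seminorm 𝕜 X)) τ

variable {𝕜} in
/-- `Γ` is norming: `‖x‖ = sup_{p ∈ Γ} p x` for all `x`. -/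
def IsNorming (Γ : Set (Seminorm 𝕜 X)) : Prop :=
  ∀ x : X, IsLUB ((fun p : Seminorm 𝕜 X => p x) '' Γ) ‖x‖

/-- `(X, ‖·‖, τ)` is a Saks space (for a Banach space `X`). -/
structure IsSaksSpace (τ : TopologicalSpace X) : Prop where
  hausdorff_lc : IsHausdorffLocallyConvex 𝕜 τ
  coarser : normTopology X ≤ τ
  exists_norming : ∃ Γ : Set (Seminorm 𝕜 X), IsGeneratingSystem 𝕜 Γ τ ∧ IsNorming Γ

/-- Every Cauchy sequence for the group topology `σ` converges with respect to `σ`. -/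
def IsSeqComplete {X : Type*} [AddCommGroup X] (σ : TopologicalSpace X) : Prop :=
  ∀ u : ℕ → X, Tendsto (fun k : ℕ × ℕ => u k.1 - u k.2) atTop (@nhds X σ 0) →
    ∃ x : X, Tendsto u atTop (@nhds X σ x)

/-- `(X, ‖·‖, τ)` is a sequentially complete Saks space: `(X, γ)` is sequentially complete. -/
structure IsSeqCompleteSaksSpace (τ : TopologicalSpace X) : Prop extends IsSaksSpace 𝕜 τ where
  seqComplete : IsSeqComplete (mixedTopology 𝕜 τ)

variable {𝕜} in
/-- If `τ` is itself linear and coarser than the norm topology, then `mixedTopology 𝕜 τ` is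
indeed the finest topology in `mixedCandidates 𝕜 τ`. -/
theorem isLeast_mixedTopology {τ : TopologicalSpace X} (hτ : IsVectorTopology 𝕜 τ)
    (hn : normTopology X ≤ τ) : IsLeast (mixedCandidates 𝕜 τ) (mixedTopology 𝕜 τ) := by
  have hmem : τ ∈ mixedCandidates 𝕜 τ := ⟨hτ, fun _ _ => rfl, le_rfl, hn⟩
  refine ⟨⟨⟨?_, ?_⟩, ?_, sInf_le hmem, le_sInf fun σ hσ => hσ.2.2.2⟩, fun σ hσ => sInf_le hσ⟩
  · exact topologicalAddGroup_sInf fun σ hσ => hσ.1.1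
  · exact continuousSMul_sInf fun σ hσ => hσ.1.2
  · intro B hB
    unfold mixedTopology
    rw [sInf_eq_iInf, induced_iInf]
    refine le_antisymm ((iInf_le _ τ).trans ?_) (le_iInf fun σ => ?_)
    · rw [induced_iInf]
      exact iInf_le _ hmem
    · rw [induced_iInf]
      exact le_iInf fun hσ => (hσ.2.1 B hB).ge

end Topologies

section Semigroups

/-- A family `(T(t))_{t ≥ 0}` in `𝓛(X)`, the norm-continuous linear operators on `X`. (Naming this
type outside the scope of any further topology on `X` fixes the norm topology in it.) -/
abbrev OperatorFamily (𝕜 X : Type*) [RCLike 𝕜] [NormedAddCommGroup X] [NormedSpace 𝕜 X] :=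
  ℝ≥0 → X →L[𝕜] X

variable {𝕜 X : Type*} [RCLike 𝕜] [NormedAddCommGroup X] [NormedSpace 𝕜 X]

/-- `(T(t))_{t ≥ 0}` is a `τ`-bi-continuous semigroup on `X`. -/
structure IsBiContinuousSemigroup (τ : TopologicalSpace X) (T : OperatorFamily 𝕜 X) : Prop where
  map_zero : ∀ x : X, T 0 x = x
  map_add : ∀ (t s : ℝ≥0) (x : X), T (t + s) x = T t (T s x)
  strongly_continuous : ∀ x : X, @Continuous ℝ≥0 X _ τ (fun t => T t x)
  exp_bounded : ∃ M ω : ℝ, 1 ≤ M ∧ ∀ t : ℝ≥0, ‖T t‖ ≤ M * Real.exp (ω * t)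
  /-- Local bi-equicontinuity; locally uniformly on `[0, ∞)` means uniformly on each `[0, t₀]`. -/
  locally_bi_equicontinuous : ∀ (u : ℕ → X) (x : X), Bornology.IsBounded (Set.range u) →
    Tendsto u atTop (@nhds X τ x) →
      ∀ t₀ : ℝ≥0, ∀ U ∈ @nhds X τ 0, ∀ᶠ n in atTop, ∀ t : ℝ≥0, t ≤ t₀ → T t (u n - x) ∈ U

/-- `T` is contractive: `‖T(t)‖ ≤ 1` for all `t ≥ 0`. -/
def IsContractive (T : OperatorFamily 𝕜 X) : Prop :=
  ∀ t : ℝ≥0, ‖T t‖ ≤ 1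

/-- The difference quotient `(T(t)x - x) / t`. -/
noncomputable def diffQuot (T : OperatorFamily 𝕜 X) (x : X) (t : ℝ≥0) : X :=
  (((t : ℝ) : 𝕜)⁻¹) • (T t x - x)

/-- The linear operator `(A, D(A))` is the generator of `T`: the domain consists of all `x` for
which the difference quotients have a `τ`-limit as `t → 0+` and are norm bounded on
`(0, 1]`, and `A x` is that limit. -/
structure IsGenerator (τ : TopologicalSpace X) (T : OperatorFamily 𝕜 X) (A : X →ₗ.[𝕜] X) :
    Prop where
  mem_domain_iff : ∀ x : X, x ∈ A.domain ↔
    (∃ y : X, Tendsto (diffQuot T x) (𝓝[>] 0) (@nhds X τ y)) ∧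
      ∃ C : ℝ, ∀ t : ℝ≥0, 0 < t → t ≤ 1 → ‖T t x - x‖ / t ≤ C
  tendsto_apply : ∀ x : A.domain, Tendsto (diffQuot T (x : X)) (𝓝[>] 0) (@nhds X τ (A x))

/-- `(A, D(A))` generates a `τ`-bi-continuous contraction semigroup on `X`. -/
def GeneratesBiContinuousContractionSemigroup (τ : TopologicalSpace X) (A : X →ₗ.[𝕜] X) : Prop :=
  ∃ T : OperatorFamily 𝕜 X, IsBiContinuousSemigroup τ T ∧ IsContractive T ∧ IsGenerator τ T A

/-- Every `x` is the `τ`-limit of a `‖·‖`-bounded sequence in `D(A)`. -/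
def IsBiDenselyDefined (τ : TopologicalSpace X) (A : X →ₗ.[𝕜] X) : Prop :=
  ∀ x : X, ∃ u : ℕ → X, (∀ n, u n ∈ A.domain) ∧ Bornology.IsBounded (Set.range u) ∧
    Tendsto u atTop (@nhds X τ x)

/-- `A` is `Γ`-dissipative: `p((r - A)x) ≥ r p(x)` for all `r > 0`, `x ∈ D(A)`, `p ∈ Γ`. -/
def IsDissipative (Γ : Set (Seminorm 𝕜 X)) (A : X →ₗ.[𝕜] X) : Prop :=
  ∀ r : ℝ, 0 < r → ∀ x : A.domain, ∀ p ∈ Γ, r * p (x : X) ≤ p ((r : 𝕜) • (x : X) - A x)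

end Semigroups

end SaksSpace

/-! Surjectivity gives generation by Yosida approximation, carried out seminorm by seminorm.
Dissipativity says that every `p ∈ Γ` is contracted by `r R(r, A)`; since `Γ` is norming, so is the
norm, and a Neumann series spreads surjectivity to all `r > 0`. The Yosida approximants are then
bounded commuting operators whose exponentials contract each `p`. `seminorm_expSemigroup_sub_le`
bounds the difference of two exponentials at `z ∈ D(A)` by the difference of the approximants at
`z`, so density and completeness produce a limit semigroup (`exists_limit_semigroup`), still
contractive for each `p`. Its generator extends `A`; as `1 - A` is onto and `1` minus the generator
is injective, they coincide (`generates_of_surjectiveAt`).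

Density and completeness are given for `τ` and `γ`, the estimates for `υ`. The bridge is that norm
bounded `τ`-convergent sequences are `γ`-convergent, hence `υ`-convergent to the same limit.

For the converse, `S(t) = e^{-t} T(t)` has generator `A - 1`, and `x = ∫ S(t) y dt` over `[0, ∞)`
should solve `(1 - A) x = y`. Only the integral `z` over `[0, 1]` is built, as a limit of Riemann
sums tested against functionals dominated by a seminorm. Then `x = ∑ S(k) z` converges in norm, and
the derivative of `S(h) x` at `h = 0` is the telescoping sum `∑ S(k) (S(1) y - y) = -y`
(`IsStableSemigroup.exists_diffQuot_tendsto`). -/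

namespace SaksSpace

/-! ### Exponentials of bounded operators, estimated in one seminorm. -/

section Exponential

variable {𝕜 X : Type*} [RCLike 𝕜] [NormedAddCommGroup X] [NormedSpace 𝕜 X]

theorem continuous_of_le_norm {p : Seminorm 𝕜 X} (hp : ∀ x, p x ≤ ‖x‖) : Continuous p :=
  Seminorm.continuous_of_le (q := normSeminorm 𝕜 X) (by simpa using continuous_norm) hp

/-- Mean value inequality for a continuous seminorm. -/
theorem seminorm_sub_le_of_deriv_le {p : Seminorm 𝕜 X} (hp : Continuous p) {F F' : 𝕜 → X}
    (hF : ∀ s, HasDerivAt F (F' s) s) {t C : ℝ} (ht : 0 ≤ t)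
    (hC : ∀ s : ℝ, 0 ≤ s → s ≤ t → p (F' (s : 𝕜)) ≤ C) :
    p (F (t : 𝕜) - F 0) ≤ C * t := by
  have hcont : Continuous F := continuous_iff_continuousAt.2 fun s => (hF s).continuousAt
  have hof : Continuous (fun s : ℝ => (s : 𝕜)) := RCLike.continuous_ofReal
  have := image_le_of_liminf_slope_right_le_deriv_boundary
    (f := fun s : ℝ => p (F (s : 𝕜) - F 0)) (a := 0) (b := t) (B := fun s => C * s)
    (B' := fun _ => C) (hp.comp ((hcont.comp hof).sub continuous_const)).continuousOn
    (by simp) (by fun_prop)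
    (fun x _ => by simpa using ((hasDerivAt_id x).const_mul C).hasDerivWithinAt) ?_
    (Set.right_mem_Icc.2 ht)
  · simpa using this
  -- `p (F s - F 0)` need not be differentiable in `s`; its right difference quotients are at most
  -- `p` of the slope of `F`, which suffices.
  intro s hs r hr
  have h1 : Tendsto (fun z : ℝ => (z : 𝕜)) (𝓝[>] s) (𝓝[≠] (s : 𝕜)) := by
    refine tendsto_nhdsWithin_of_tendsto_nhds_of_eventually_within _
      (hof.continuousAt.tendsto.mono_left nhdsWithin_le_nhds) ?_
    filter_upwards [self_mem_nhdsWithin] with z hz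
    simpa using (Set.mem_Ioi.1 hz).ne'
  have h2 := hp.continuousAt.tendsto.comp ((hasDerivAt_iff_tendsto_slope.1 (hF (s : 𝕜))).comp h1)
  refine Eventually.frequently ?_
  filter_upwards [h2.eventually (gt_mem_nhds ((hC s hs.1 hs.2.le).trans_lt hr)),
    self_mem_nhdsWithin] with z hz hsz
  refine lt_of_le_of_lt ?_ hz
  have hpos : 0 < z - s := sub_pos.2 hsz
  have h3 : p (F (z : 𝕜) - F 0) - p (F (s : 𝕜) - F 0) ≤ p (F (z : 𝕜) - F (s : 𝕜)) := by
    have := map_add_le_add p (F (z : 𝕜) - F (s : 𝕜)) (F (s : 𝕜) - F 0)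
    rw [sub_add_sub_cancel] at this
    linarith
  simp only [slope_def_module, Function.comp_apply, map_smul_eq_mul, smul_eq_mul]
  rw [← RCLike.ofReal_sub, norm_inv, RCLike.norm_ofReal, abs_of_pos hpos]
  gcongr

/-- The semigroup `t ↦ exp (t B)` of a bounded operator. -/
noncomputable def expSemigroup (B : X →L[𝕜] X) (t : ℝ) : X →L[𝕜] X :=
  NormedSpace.exp ((t : 𝕜) • B)

@[simp] theorem expSemigroup_zero (B : X →L[𝕜] X) : expSemigroup B 0 = 1 := by
  simp [expSemigroup]

variable [CompleteSpace X]

theorem exp_add_of_commute_clm {B C : X →L[𝕜] X} (h : Commute B C) :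
    NormedSpace.exp (B + C) = NormedSpace.exp B * NormedSpace.exp C := by
  apply NormedSpace.exp_add_of_commute_of_mem_ball (𝕂 := 𝕜) h <;>
  · rw [NormedSpace.expSeries_radius_eq_top]
    exact edist_lt_top _ _

theorem expSemigroup_add (B : X →L[𝕜] X) (t s : ℝ) :
    expSemigroup B (t + s) = expSemigroup B t * expSemigroup B s := by
  rw [expSemigroup, RCLike.ofReal_add, add_smul]
  exact exp_add_of_commute_clm (((Commute.refl B).smul_left _).smul_right _)

theorem hasDerivAt_exp_smul_apply (B : X →L[𝕜] X) (x : X) (z : 𝕜) :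
    HasDerivAt (fun u : 𝕜 => NormedSpace.exp (u • B) x) (NormedSpace.exp (z • B) (B x)) z := by
  simpa using (hasDerivAt_exp_smul_const B z).clm_apply (hasDerivAt_const z x)

theorem seminorm_exp_smul_le {p : Seminorm 𝕜 X} (hp : Continuous p) {K : X →L[𝕜] X}
    (hK : ∀ x, p (K x) ≤ p x) {c : ℝ} (hc : 0 ≤ c) (x : X) :
    p (NormedSpace.exp ((c : 𝕜) • K) x) ≤ Real.exp c * p x := by
  have h1 := (NormedSpace.exp_series_hasSum_exp' (𝕂 := 𝕜) ((c : 𝕜) • K)).mapL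
    (ContinuousLinearMap.apply 𝕜 X x)
  refine le_of_tendsto (hp.continuousAt.tendsto.comp h1) (Eventually.of_forall fun s => ?_)
  have hpow : ∀ n, p ((K ^ n) x) ≤ p x := by
    intro n
    induction n with
    | zero => simp
    | succ n ih => rw [pow_succ']; exact (hK _).trans ih
  have h2 : HasSum (fun n : ℕ => c ^ n / n.factorial) (Real.exp c) := by
    rw [Real.exp_eq_exp_ℝ]
    exact NormedSpace.expSeries_div_hasSum_exp c
  calc p (∑ n ∈ s, (ContinuousLinearMap.apply 𝕜 X x) ((n.factorial⁻¹ : 𝕜) • ((c : 𝕜) • K) ^ n))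
      ≤ ∑ n ∈ s, p ((ContinuousLinearMap.apply 𝕜 X x)
          ((n.factorial⁻¹ : 𝕜) • ((c : 𝕜) • K) ^ n)) :=
        Finset.le_sum_of_subadditive p (map_zero p).le (map_add_le_add p) _ _
    _ ≤ ∑ n ∈ s, c ^ n / n.factorial * p x := by
        refine Finset.sum_le_sum fun n _ => ?_
        simp only [smul_pow, map_smul, ContinuousLinearMap.apply_apply, map_smul_eq_mul]
        rw [norm_inv, RCLike.norm_natCast, norm_pow, RCLike.norm_ofReal, abs_of_nonneg hc,
          ← mul_assoc, div_eq_inv_mul]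
        gcongr
        exact hpow n
    _ = (∑ n ∈ s, c ^ n / n.factorial) * p x := by rw [Finset.sum_mul]
    _ ≤ _ := by
        gcongr
        exact sum_le_hasSum _ (fun n _ => by positivity) h2

/-- Splitting off the scalar part gives `exp (ta(K - 1)) = e^{-ta} exp (taK)`, and the factor
`e^{-ta}` cancels the growth `e^{ta}` allowed by the power series. -/
theorem seminorm_expSemigroup_le {p : Seminorm 𝕜 X} (hp : Continuous p) {K : X →L[𝕜] X}
    (hK : ∀ x, p (K x) ≤ p x) {a t : ℝ} (ha : 0 ≤ a) (ht : 0 ≤ t) (x : X) :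
    p (expSemigroup ((a : 𝕜) • (K - 1)) t x) ≤ p x := by
  have h1 : (t : 𝕜) • ((a : 𝕜) • (K - 1)) =
      ((-(t * a) : ℝ) : 𝕜) • 1 + ((t * a : ℝ) : 𝕜) • K := by
    push_cast
    module
  have h2 : NormedSpace.exp (((-(t * a) : ℝ) : 𝕜) • (1 : X →L[𝕜] X)) =
      ((Real.exp (-(t * a)) : ℝ) : 𝕜) • 1 := by
    rw [← Algebra.algebraMap_eq_smul_one, ← NormedSpace.algebraMap_exp_comm,
      Algebra.algebraMap_eq_smul_one, Real.exp_eq_exp_ℝ]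
    congr 1
    exact (NormedSpace.algebraMap_exp_comm (𝕂 := ℝ) (𝔸 := 𝕜) _).symm
  rw [expSemigroup, h1, exp_add_of_commute_clm ((Commute.one_left _).smul_left _), h2]
  simp only [smul_mul_assoc, one_mul, smul_apply, map_smul_eq_mul,
    RCLike.norm_ofReal, Real.abs_exp]
  calc _ ≤ Real.exp (-(t * a)) * (Real.exp (t * a) * p x) := by
        gcongr
        exact seminorm_exp_smul_le hp hK (by positivity) x
    _ = p x := by rw [← mul_assoc, ← Real.exp_add]; simp

/-- `p (exp (tB) x - x - t v) ≤ C t` if `p (exp (sB) B x - v) ≤ C` on `[0, t]`. -/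
theorem seminorm_expSemigroup_sub_sub_le {p : Seminorm 𝕜 X} (hp : Continuous p) (B : X →L[𝕜] X)
    (x v : X) {t C : ℝ} (ht : 0 ≤ t)
    (hC : ∀ s : ℝ, 0 ≤ s → s ≤ t → p (expSemigroup B s (B x) - v) ≤ C) :
    p (expSemigroup B t x - x - (t : 𝕜) • v) ≤ C * t := by
  have := seminorm_sub_le_of_deriv_le hp
    (F := fun u => NormedSpace.exp (u • B) x - u • v)
    (fun z => (hasDerivAt_exp_smul_apply B x z).sub
      (by simpa using (hasDerivAt_id z).smul_const v)) ht hC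
  convert! this using 2
  simp [expSemigroup]
  abel

/-- Comparison of the exponentials of two commuting operators. -/
theorem seminorm_expSemigroup_sub_le {p : Seminorm 𝕜 X} (hp : Continuous p) {B C : X →L[𝕜] X}
    (hBC : Commute B C) (hB : ∀ t : ℝ, 0 ≤ t → ∀ x, p (expSemigroup B t x) ≤ p x)
    (hC : ∀ t : ℝ, 0 ≤ t → ∀ x, p (expSemigroup C t x) ≤ p x) {t : ℝ} (ht : 0 ≤ t) (x : X) :
    p (expSemigroup B t x - expSemigroup C t x) ≤ p (B x - C x) * t := by
  have hB' : ∀ z : 𝕜, Commute B (NormedSpace.exp (z • C)) := fun z =>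
    (hBC.smul_right z).exp_right
  -- The path `u ↦ exp (uB) exp ((t - u)C) x` joins `exp (tC) x` to `exp (tB) x`; commutation brings
  -- `B - C` next to `x` in its derivative.
  have hd : ∀ z : 𝕜, HasDerivAt
      (fun u : 𝕜 => NormedSpace.exp (u • B) (NormedSpace.exp (((t : 𝕜) - u) • C) x))
      (NormedSpace.exp (z • B) (NormedSpace.exp (((t : 𝕜) - z) • C) (B x - C x))) z := by
    intro z
    have h1 : HasDerivAt (fun u : 𝕜 => NormedSpace.exp (((t : 𝕜) - u) • C) x)
        (-NormedSpace.exp (((t : 𝕜) - z) • C) (C x)) z := by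
      simpa [Function.comp_def] using (hasDerivAt_exp_smul_apply C x ((t : 𝕜) - z)).scomp z
        ((hasDerivAt_id z).const_sub (t : 𝕜))
    convert! (hasDerivAt_exp_smul_const B z).clm_apply h1 using 1
    have := congrArg (fun D : X →L[𝕜] X => D x) (hB' ((t : 𝕜) - z)).eq
    simp only [mul_apply_eq_comp] at this
    simp [this, ← sub_eq_add_neg]
  have := seminorm_sub_le_of_deriv_le hp hd ht (C := p (B x - C x)) ?_
  · simpa [expSemigroup] using this
  intro s hs hst
  refine (hB s hs _).trans ?_
  have := hC (t - s) (by linarith) (B x - C x)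
  simpa [expSemigroup] using this

end Exponential

/-! ### Resolvents of a dissipative operator. -/

section Resolvent

variable {𝕜 X : Type*} [RCLike 𝕜] [NormedAddCommGroup X] [NormedSpace 𝕜 X]
  {Γ : Set (Seminorm 𝕜 X)} {A : X →ₗ.[𝕜] X}

theorem IsNorming.le_norm (h : IsNorming Γ) {p : Seminorm 𝕜 X} (hp : p ∈ Γ) (x : X) :
    p x ≤ ‖x‖ :=
  (h x).1 ⟨p, hp, rfl⟩

theorem IsNorming.norm_le (h : IsNorming Γ) {x : X} {C : ℝ} (hC : ∀ p ∈ Γ, p x ≤ C) :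
    ‖x‖ ≤ C :=
  (h x).2 (by rintro _ ⟨p, hp, rfl⟩; exact hC p hp)

theorem IsNorming.continuous (h : IsNorming Γ) {p : Seminorm 𝕜 X} (hp : p ∈ Γ) :
    Continuous p :=
  continuous_of_le_norm (h.le_norm hp)

theorem IsNorming.eq_zero (h : IsNorming Γ) {x : X} (hx : ∀ p ∈ Γ, p x ≤ 0) : x = 0 :=
  norm_le_zero_iff.1 (h.norm_le hx)

/-- `r - A` is surjective onto `X`. -/
def SurjectiveAt (A : X →ₗ.[𝕜] X) (r : ℝ) : Prop :=
  Function.Surjective (fun x : A.domain => (r : 𝕜) • (x : X) - A x)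

/-- `R` is the inverse of `r - A`. -/
structure IsResolventAt (A : X →ₗ.[𝕜] X) (r : ℝ) (R : X →L[𝕜] X) : Prop where
  mem : ∀ x, R x ∈ A.domain
  right_inv : ∀ x, (r : 𝕜) • R x - A ⟨R x, mem x⟩ = x
  left_inv : ∀ x : A.domain, R ((r : 𝕜) • (x : X) - A x) = x

theorem IsResolventAt.map_apply {r : ℝ} {R : X →L[𝕜] X} (h : IsResolventAt A r R) (x : X) :
    A ⟨R x, h.mem x⟩ = (r : 𝕜) • R x - x :=
  eq_sub_of_add_eq (sub_eq_iff_eq_add'.1 (h.right_inv x)).symm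

theorem IsDissipative.norm_le (hA : IsDissipative Γ A) (hΓ : IsNorming Γ) {r : ℝ} (hr : 0 < r)
    (x : A.domain) : r * ‖(x : X)‖ ≤ ‖(r : 𝕜) • (x : X) - A x‖ := by
  rw [← le_div_iff₀' hr]
  refine hΓ.norm_le fun p hp => ?_
  rw [le_div_iff₀' hr]
  exact (hA r hr x p hp).trans (hΓ.le_norm hp _)

theorem IsDissipative.exists_resolvent (hA : IsDissipative Γ A) (hΓ : IsNorming Γ) {r : ℝ}
    (hr : 0 < r) (hs : SurjectiveAt A r) : ∃ R : X →L[𝕜] X, IsResolventAt A r R := by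
  let L : A.domain →ₗ[𝕜] X := (r : 𝕜) • A.domain.subtype - A.toFun
  have hL : ∀ x, L x = (r : 𝕜) • (x : X) - A x := fun x => rfl
  have hinj : Function.Injective L := by
    refine (injective_iff_map_eq_zero L).2 fun x hx => ?_
    have := hA.norm_le hΓ hr x
    rw [← hL, hx, norm_zero] at this
    have h0 : ‖(x : X)‖ ≤ 0 := by
      by_contra! h
      exact absurd this (not_le.2 (mul_pos hr h))
    exact Subtype.ext (norm_le_zero_iff.1 h0)
  let e := LinearEquiv.ofBijective L ⟨hinj, hs⟩
  have he : ∀ x, (r : 𝕜) • (e.symm x : X) - A (e.symm x) = x := fun x => e.apply_symm_apply x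
  refine ⟨(A.domain.subtype ∘ₗ e.symm.toLinearMap).mkContinuous r⁻¹ fun x => ?_,
    fun x => (e.symm x).2, fun x => he x, fun x => ?_⟩
  · have := hA.norm_le hΓ hr (e.symm x)
    rw [he] at this
    rw [inv_mul_eq_div, le_div_iff₀' hr]
    exact this
  · exact congrArg Subtype.val (e.symm_apply_apply x)

theorem IsDissipative.seminorm_resolvent_le (hA : IsDissipative Γ A) {r : ℝ} (hr : 0 < r)
    {R : X →L[𝕜] X} (hR : IsResolventAt A r R) {p : Seminorm 𝕜 X} (hp : p ∈ Γ) (x : X) :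
    r * p (R x) ≤ p x := by
  have := hA r hr ⟨R x, hR.mem x⟩ p hp
  rwa [hR.right_inv] at this

/-- The resolvent identity. -/
theorem IsResolventAt.sub_apply {r s : ℝ} {R S : X →L[𝕜] X} (hR : IsResolventAt A r R)
    (hS : IsResolventAt A s S) (x : X) : R x - S x = ((s - r : ℝ) : 𝕜) • R (S x) := by
  have h := hR.left_inv (⟨R x, hR.mem x⟩ - ⟨S x, hS.mem x⟩)
  have h1 : A (⟨R x, hR.mem x⟩ - ⟨S x, hS.mem x⟩) =
      ((r : 𝕜) • R x - x) - ((s : 𝕜) • S x - x) := by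
    rw [A.map_sub, hR.map_apply, hS.map_apply]
  rw [h1] at h
  rw [← map_smul]
  simp only [AddSubgroupClass.coe_sub] at h
  rw [← h]
  congr 1
  push_cast
  module

/-- For `r ≠ s`, compare the two resolvent identities obtained by exchanging `R` and `S`; for `r =
s` the resolvents are equal. -/
theorem IsResolventAt.commute {r s : ℝ} {R S : X →L[𝕜] X} (hR : IsResolventAt A r R)
    (hS : IsResolventAt A s S) : Commute R S := by
  ext x
  simp only [mul_apply_eq_comp]
  by_cases h : s = r
  · subst h
    have h0 : ∀ y, R y = S y := fun y => by simpa [sub_eq_zero] using hR.sub_apply hS y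
    rw [h0, h0 x]
  have h1 := hR.sub_apply hS x
  have h2 := hS.sub_apply hR x
  have h3 : ((s - r : ℝ) : 𝕜) • R (S x) = ((s - r : ℝ) : 𝕜) • S (R x) := by
    rw [← h1, ← neg_sub (S x), h2, ← neg_smul]
    push_cast
    rw [neg_sub]
  exact smul_right_injective X (r := ((s - r : ℝ) : 𝕜))
    (by exact_mod_cast sub_ne_zero.2 h) h3

variable [CompleteSpace X]

/-- Since `(s - A) R = 1 - (r - s) R` and `‖R‖ ≤ 1/r`, the right-hand side is invertible by a
Neumann series. -/
theorem IsDissipative.surjectiveAt_of_lt (hA : IsDissipative Γ A) (hΓ : IsNorming Γ) {r s : ℝ}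
    (hr : 0 < r) (h : SurjectiveAt A r) (hs : |s - r| < r) : SurjectiveAt A s := by
  obtain ⟨R, hR⟩ := hA.exists_resolvent hΓ hr h
  have hRn : ‖R‖ ≤ r⁻¹ := by
    refine R.opNorm_le_bound (by positivity) fun x => hΓ.norm_le fun p hp => ?_
    rw [inv_mul_eq_div, le_div_iff₀' hr]
    exact (hA.seminorm_resolvent_le hr hR hp x).trans (hΓ.le_norm hp x)
  have hn : ‖((r - s : ℝ) : 𝕜) • R‖ < 1 := by
    calc ‖((r - s : ℝ) : 𝕜) • R‖ ≤ |s - r| * r⁻¹ := by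
          rw [norm_smul, RCLike.norm_ofReal, abs_sub_comm]
          gcongr
      _ < r * r⁻¹ := by gcongr
      _ = 1 := mul_inv_cancel₀ hr.ne'
  obtain ⟨u, hu⟩ := isUnit_one_sub_of_norm_lt_one hn
  intro y
  have hw : (1 - ((r - s : ℝ) : 𝕜) • R) ((↑u⁻¹ : X →L[𝕜] X) y) = y := by
    rw [← hu, ← mul_apply_eq_comp, Units.mul_inv]
    rfl
  set w := (↑u⁻¹ : X →L[𝕜] X) y
  refine ⟨⟨R w, hR.mem w⟩, ?_⟩
  have h1 := hR.right_inv w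
  rw [← hw]
  simp only [sub_apply, one_apply_eq_self, smul_apply]
  conv_rhs => rw [← h1]
  simp only [map_sub, map_smul]
  have h2 : R ((r : 𝕜) • R w - A ⟨R w, hR.mem w⟩) = R w := by rw [h1]
  rw [map_sub, map_smul] at h2
  rw [h2]
  module

theorem IsDissipative.surjectiveAt (hA : IsDissipative Γ A) (hΓ : IsNorming Γ) {r s : ℝ}
    (hr : 0 < r) (h : SurjectiveAt A r) (hs : 0 < s) : SurjectiveAt A s := by
  -- Any ratio strictly between 1 and 2 would do. Once the parameter exceeds `s`, a single step
  -- comes back down to `s`.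
  have key : ∀ n : ℕ, SurjectiveAt A ((3 / 2) ^ n * r) := by
    intro n
    induction n with
    | zero => simpa using h
    | succ n ih =>
      have : 0 < (3 / 2 : ℝ) ^ n * r := by positivity
      refine hA.surjectiveAt_of_lt hΓ this ih ?_
      rw [abs_lt, pow_succ]
      constructor <;> linarith
  obtain ⟨n, hn⟩ := pow_unbounded_of_one_lt (s / r) (by norm_num : (1 : ℝ) < 3 / 2)
  rw [div_lt_iff₀ hr] at hn
  refine hA.surjectiveAt_of_lt hΓ (hs.trans hn) (key n) ?_
  rw [abs_lt]
  constructor <;> linarith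

end Resolvent

/-! ### Yosida approximants and the limit semigroup. -/

section Yosida

variable {𝕜 X : Type*} [RCLike 𝕜] [NormedAddCommGroup X] [NormedSpace 𝕜 X]
  {Γ : Set (Seminorm 𝕜 X)} {A : X →ₗ.[𝕜] X}

/-- `u` converges to `x` with respect to every seminorm in `Γ`. -/
def SeminormTendsto (Γ : Set (Seminorm 𝕜 X)) (u : ℕ → X) (x : X) : Prop :=
  ∀ p ∈ Γ, Tendsto (fun n => p (u n - x)) atTop (𝓝 0)

/-- Norm bounded sequences that are Cauchy for every seminorm in `Γ` converge. -/
def BoundedlySeqComplete (Γ : Set (Seminorm 𝕜 X)) : Prop :=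
  ∀ u : ℕ → X, (∃ C, ∀ n, ‖u n‖ ≤ C) →
    (∀ p ∈ Γ, ∀ ε > 0, ∃ N, ∀ n ≥ N, ∀ m ≥ N, p (u n - u m) < ε) →
      ∃ x, SeminormTendsto Γ u x

/-- `D(A)` is dense for every single seminorm in `Γ`. -/
def SeminormDense (Γ : Set (Seminorm 𝕜 X)) (A : X →ₗ.[𝕜] X) : Prop :=
  ∀ x, ∀ p ∈ Γ, ∀ ε > 0, ∃ z : A.domain, p (x - z) < ε

theorem SeminormTendsto.tendsto_sub {u : ℕ → X} {x : X} (h : SeminormTendsto Γ u x)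
    {p : Seminorm 𝕜 X} (hp : p ∈ Γ) (w : X) :
    Tendsto (fun n => p (u n - w)) atTop (𝓝 (p (x - w))) := by
  rw [tendsto_iff_dist_tendsto_zero]
  refine squeeze_zero (fun _ => dist_nonneg) (fun n => ?_) (h p hp)
  rw [Real.dist_eq]
  simpa using abs_sub_map_le_sub p (u n - w) (x - w)

theorem SeminormTendsto.sub_le {u : ℕ → X} {x : X} (h : SeminormTendsto Γ u x)
    {p : Seminorm 𝕜 X} (hp : p ∈ Γ) {w : X} {C : ℝ} (hC : ∀ n, p (u n - w) ≤ C) :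
    p (x - w) ≤ C :=
  le_of_tendsto' (h.tendsto_sub hp w) hC

theorem SeminormTendsto.unique (hΓ : IsNorming Γ) {u : ℕ → X} {x y : X}
    (hx : SeminormTendsto Γ u x) (hy : SeminormTendsto Γ u y) : x = y :=
  sub_eq_zero.1 (hΓ.eq_zero fun p hp =>
    (tendsto_nhds_unique (hx.tendsto_sub hp y) (hy p hp)).le)

theorem SeminormTendsto.add {u v : ℕ → X} {x y : X} (hu : SeminormTendsto Γ u x)
    (hv : SeminormTendsto Γ v y) : SeminormTendsto Γ (fun n => u n + v n) (x + y) := by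
  intro p hp
  have h0 := (hu p hp).add (hv p hp)
  rw [add_zero] at h0
  refine squeeze_zero (fun _ => apply_nonneg _ _) (fun n => ?_) h0
  rw [add_sub_add_comm]
  exact map_add_le_add p _ _

theorem SeminormTendsto.const_smul {u : ℕ → X} {x : X} (hu : SeminormTendsto Γ u x) (c : 𝕜) :
    SeminormTendsto Γ (fun n => c • u n) (c • x) := by
  intro p hp
  simpa [← smul_sub, map_smul_eq_mul] using (hu p hp).const_mul ‖c‖

/-- The approximants `(n+1) A R(n+1, A)`, for `R n = R(n+1, A)`. -/
noncomputable def yosida (R : ℕ → X →L[𝕜] X) (n : ℕ) : X →L[𝕜] X :=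
  ((n + 1 : ℝ) : 𝕜) • (((n + 1 : ℝ) : 𝕜) • R n - 1)

variable {R : ℕ → X →L[𝕜] X}

theorem seminorm_smul_resolvent_le (hA : IsDissipative Γ A)
    (hR : ∀ n : ℕ, IsResolventAt A (n + 1) (R n)) {p : Seminorm 𝕜 X} (hp : p ∈ Γ) (n : ℕ) (x : X) :
    p ((((n + 1 : ℝ) : 𝕜) • R n) x) ≤ p x := by
  have hn : (0 : ℝ) < n + 1 := by positivity
  rw [smul_apply, map_smul_eq_mul, RCLike.norm_ofReal, abs_of_pos hn]
  exact hA.seminorm_resolvent_le hn (hR n) hp x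

theorem smul_resolvent_sub_self (hR : ∀ n : ℕ, IsResolventAt A (n + 1) (R n)) (n : ℕ)
    (z : A.domain) : (((n + 1 : ℝ) : 𝕜) • R n) (z : X) - z = R n (A z) := by
  have h := (hR n).left_inv z
  rw [map_sub, map_smul] at h
  rw [smul_apply]
  nth_rw 2 [← h]
  abel

theorem yosida_apply (hR : ∀ n : ℕ, IsResolventAt A (n + 1) (R n)) (n : ℕ)
    (z : A.domain) : yosida R n (z : X) = (((n + 1 : ℝ) : 𝕜) • R n) (A z) := by
  rw [yosida, smul_apply, sub_apply, one_apply_eq_self, smul_resolvent_sub_self hR, smul_apply]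

/-- On `D(A)` the error is `R n (A z)`, of size `p (A z) / (n + 1)`; contractivity for `p` extends
convergence to all `x` by density. -/
theorem tendsto_smul_resolvent (hA : IsDissipative Γ A) (hd : SeminormDense Γ A)
    (hR : ∀ n : ℕ, IsResolventAt A (n + 1) (R n)) (x : X) :
    SeminormTendsto Γ (fun n => (((n + 1 : ℝ) : 𝕜) • R n) x) x := by
  intro p hp
  refine tendsto_order.2 ⟨fun a ha => Eventually.of_forall fun n => ha.trans_le
    (apply_nonneg _ _), fun ε hε => ?_⟩
  obtain ⟨z, hz⟩ := hd x p hp (ε / 4) (by positivity)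
  have h0 : Tendsto (fun n : ℕ => p (A z) / ((n : ℝ) + 1)) atTop (𝓝 0) :=
    tendsto_const_nhds.div_atTop (tendsto_atTop_add_const_right _ _ tendsto_natCast_atTop_atTop)
  filter_upwards [h0.eventually (gt_mem_nhds (half_pos hε))] with n hn
  have hn0 : (0 : ℝ) < n + 1 := by positivity
  set K := ((n + 1 : ℝ) : 𝕜) • R n
  have e : K x - x = K (x - z) + ((K z - z) + (z - x)) := by
    rw [map_sub]; abel
  have h1 := map_add_le_add p (K (x - z)) ((K z - z) + (z - x))
  have h2 := map_add_le_add p (K z - z) (z - x)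
  have h3 := seminorm_smul_resolvent_le hA hR hp n (x - z)
  have h4 : p (K z - z) ≤ p (A z) / (n + 1) := by
    rw [smul_resolvent_sub_self hR, le_div_iff₀' hn0]
    exact hA.seminorm_resolvent_le hn0 (hR n) hp _
  rw [map_sub_rev p] at hz
  rw [e]
  rw [map_sub_rev p x] at h3
  linarith

theorem tendsto_yosida (hA : IsDissipative Γ A) (hd : SeminormDense Γ A)
    (hR : ∀ n : ℕ, IsResolventAt A (n + 1) (R n)) (z : A.domain) :
    SeminormTendsto Γ (fun n => yosida R n (z : X)) (A z) := by
  simpa only [yosida_apply hR] using tendsto_smul_resolvent hA hd hR (A z)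

theorem commute_yosida (hR : ∀ n : ℕ, IsResolventAt A (n + 1) (R n)) (n m : ℕ) :
    Commute (yosida R n) (yosida R m) := by
  have := (hR n).commute (hR m)
  unfold yosida
  refine Commute.smul_right (Commute.smul_left ?_ _) _
  refine Commute.sub_left (Commute.sub_right ?_ (Commute.one_right _)) (Commute.one_left _)
  exact (this.smul_left _).smul_right _

variable [CompleteSpace X]

theorem seminorm_yosida_semigroup_le (hA : IsDissipative Γ A) (hΓ : IsNorming Γ)
    (hR : ∀ n : ℕ, IsResolventAt A (n + 1) (R n)) {p : Seminorm 𝕜 X} (hp : p ∈ Γ) (n : ℕ)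
    {t : ℝ} (ht : 0 ≤ t) (x : X) : p (expSemigroup (yosida R n) t x) ≤ p x :=
  seminorm_expSemigroup_le (hΓ.continuous hp) (seminorm_smul_resolvent_le hA hR hp n)
    (by positivity) ht x

/-- For each `p`, replace `x` by a nearby `z ∈ D(A)` at a cost uniform in `n`. At `z` the
exponentials differ by at most `t` times the difference of the approximants, which converge there.
Norming makes limits unique, hence linear in `x`. -/
theorem exists_limit_semigroup (hA : IsDissipative Γ A) (hΓ : IsNorming Γ)
    (hd : SeminormDense Γ A) (hc : BoundedlySeqComplete Γ)
    (hR : ∀ n : ℕ, IsResolventAt A (n + 1) (R n)) :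
    ∃ T : OperatorFamily 𝕜 X,
      ∀ (t : ℝ≥0) (x : X), SeminormTendsto Γ (fun n => expSemigroup (yosida R n) t x) (T t x) := by
  have hE := fun p hp n t ht x => seminorm_yosida_semigroup_le (p := p) (t := t) hA hΓ hR hp n ht x
  have hlim : ∀ (t : ℝ≥0) (x : X),
      ∃ y, SeminormTendsto Γ (fun n => expSemigroup (yosida R n) t x) y := by
    intro t x
    refine hc _ ⟨‖x‖, fun n => hΓ.norm_le fun p hp =>
      (hE p hp n t t.2 x).trans (hΓ.le_norm hp x)⟩ fun p hp ε hε => ?_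
    obtain ⟨z, hz⟩ := hd x p hp (ε / 4) (by positivity)
    have h0 := (tendsto_yosida hA hd hR z p hp).mul_const (t : ℝ)
    rw [zero_mul] at h0
    obtain ⟨N, hN⟩ := eventually_atTop.1
      (h0.eventually (gt_mem_nhds (by positivity : 0 < ε / 4)))
    refine ⟨N, fun n hn m hm => ?_⟩
    have e : expSemigroup (yosida R n) t x - expSemigroup (yosida R m) t x =
        expSemigroup (yosida R n) t (x - z) +
          ((expSemigroup (yosida R n) t (z : X) - expSemigroup (yosida R m) t (z : X)) +
            expSemigroup (yosida R m) t (z - x)) := by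
      rw [map_sub, map_sub]; abel
    have h1 := seminorm_expSemigroup_sub_le (hΓ.continuous hp) (commute_yosida hR n m)
      (fun t ht x => hE p hp n t ht x) (fun t ht x => hE p hp m t ht x) t.2 (z : X)
    have h2 := map_sub_le_add p (yosida R n (z : X) - A z) (yosida R m (z : X) - A z)
    rw [sub_sub_sub_cancel_right] at h2
    have h3 := mul_le_mul_of_nonneg_right h2 t.2
    rw [add_mul] at h3
    have h4 := map_add_le_add p (expSemigroup (yosida R n) t (x - z))
      ((expSemigroup (yosida R n) t (z : X) - expSemigroup (yosida R m) t (z : X)) +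
            expSemigroup (yosida R m) t (z - x))
    have h5 := map_add_le_add p
      (expSemigroup (yosida R n) t (z : X) - expSemigroup (yosida R m) t (z : X))
      (expSemigroup (yosida R m) t (z - x))
    have h6 := hE p hp n t t.2 (x - z)
    have h7 := hE p hp m t t.2 (z - x)
    rw [map_sub_rev p (z : X) x] at h7
    have h8 := hN n hn
    have h9 := hN m hm
    rw [e]
    simp only [NNReal.val_eq_coe] at *
    linarith
  choose F hF using hlim
  refine ⟨fun t => LinearMap.mkContinuous
    { toFun := F t
      map_add' := fun x y => (hF t (x + y)).unique hΓ
        (by simpa only [map_add] using (hF t x).add (hF t y))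
      map_smul' := fun c x => (hF t (c • x)).unique hΓ
        (by simpa only [map_smul, RingHom.id_apply] using (hF t x).const_smul c) } 1
    fun x => ?_, fun t x => hF t x⟩
  rw [one_mul]
  refine hΓ.norm_le fun p hp => ?_
  have := (hF t x).sub_le hp (w := 0) (C := ‖x‖) fun n => by
    rw [sub_zero]
    exact (hE p hp n t t.2 x).trans (hΓ.le_norm hp x)
  rwa [sub_zero] at this

/-! ### Properties of the limit semigroup. -/

section Limit

variable {T : OperatorFamily 𝕜 X}

theorem limit_seminorm_le (hA : IsDissipative Γ A) (hΓ : IsNorming Γ)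
    (hR : ∀ n : ℕ, IsResolventAt A (n + 1) (R n))
    (hT : ∀ (t : ℝ≥0) (x : X),
      SeminormTendsto Γ (fun n => expSemigroup (yosida R n) t x) (T t x))
    {p : Seminorm 𝕜 X} (hp : p ∈ Γ) (t : ℝ≥0) (x : X) : p (T t x) ≤ p x := by
  have := (hT t x).sub_le hp (w := 0) (C := p x) fun n => by
    rw [sub_zero]
    exact seminorm_yosida_semigroup_le hA hΓ hR hp n t.2 x
  rwa [sub_zero] at this

theorem limit_add (hA : IsDissipative Γ A) (hΓ : IsNorming Γ)
    (hR : ∀ n : ℕ, IsResolventAt A (n + 1) (R n))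
    (hT : ∀ (t : ℝ≥0) (x : X),
      SeminormTendsto Γ (fun n => expSemigroup (yosida R n) t x) (T t x))
    (t s : ℝ≥0) (x : X) : T (t + s) x = T t (T s x) := by
  refine (hT (t + s) x).unique hΓ fun p hp => ?_
  have h0 := (hT t (T s x) p hp).add (hT s x p hp)
  rw [add_zero] at h0
  refine squeeze_zero (fun _ => apply_nonneg _ _) (fun n => ?_) h0
  have e : expSemigroup (yosida R n) (t + s : ℝ≥0) x - T t (T s x) =
      (expSemigroup (yosida R n) t (T s x) - T t (T s x)) +
        expSemigroup (yosida R n) t (expSemigroup (yosida R n) s x - T s x) := by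
    rw [NNReal.coe_add, expSemigroup_add, mul_apply_eq_comp, map_sub]; abel
  rw [e]
  refine (map_add_le_add p _ _).trans ?_
  gcongr
  exact seminorm_yosida_semigroup_le hA hΓ hR hp n t.2 _

theorem seminorm_yosida_semigroup_sub_le (hA : IsDissipative Γ A) (hΓ : IsNorming Γ)
    (hR : ∀ n : ℕ, IsResolventAt A (n + 1) (R n)) {p : Seminorm 𝕜 X} (hp : p ∈ Γ) (n : ℕ)
    {t : ℝ} (ht : 0 ≤ t) (z : A.domain) :
    p (expSemigroup (yosida R n) t (z : X) - z) ≤ p (A z) * t := by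
  have := seminorm_expSemigroup_sub_sub_le (hΓ.continuous hp) (yosida R n) (z : X) 0 ht
    (C := p (A z)) fun s hs _ => by
      rw [sub_zero, yosida_apply hR]
      exact (seminorm_yosida_semigroup_le hA hΓ hR hp n hs _).trans
        (seminorm_smul_resolvent_le hA hR hp n _)
  simpa using this

theorem limit_sub_le (hA : IsDissipative Γ A) (hΓ : IsNorming Γ)
    (hR : ∀ n : ℕ, IsResolventAt A (n + 1) (R n))
    (hT : ∀ (t : ℝ≥0) (x : X),
      SeminormTendsto Γ (fun n => expSemigroup (yosida R n) t x) (T t x))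
    {p : Seminorm 𝕜 X} (hp : p ∈ Γ) (t : ℝ≥0) (z : A.domain) :
    p (T t (z : X) - z) ≤ p (A z) * t :=
  (hT t z).sub_le hp fun n => seminorm_yosida_semigroup_sub_le hA hΓ hR hp n t.2 z

/-- Stands in for `T(t) z - z = ∫ T(s) A z ds`. As `A z` may lie outside `D(A)`, its orbit is
controlled through an auxiliary `w ∈ D(A)`, later chosen close to `A z`. -/
theorem limit_sub_sub_le (hA : IsDissipative Γ A) (hΓ : IsNorming Γ) (hd : SeminormDense Γ A)
    (hR : ∀ n : ℕ, IsResolventAt A (n + 1) (R n))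
    (hT : ∀ (t : ℝ≥0) (x : X),
      SeminormTendsto Γ (fun n => expSemigroup (yosida R n) t x) (T t x))
    {p : Seminorm 𝕜 X} (hp : p ∈ Γ) (t : ℝ≥0) (z w : A.domain) :
    p (T t (z : X) - z - ((t : ℝ) : 𝕜) • A z) ≤ (2 * p (A z - w) + p (A w) * t) * t := by
  have h0 := ((tendsto_yosida hA hd hR z p hp).add_const (2 * p (A z - w) + p (A w) * t)).mul_const
    (t : ℝ)
  rw [zero_add] at h0
  have h1 := (hT t z).tendsto_sub hp (z + ((t : ℝ) : 𝕜) • A z)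
  rw [sub_sub]
  refine le_of_tendsto_of_tendsto' h1 h0 fun n => ?_
  rw [← sub_sub]
  refine seminorm_expSemigroup_sub_sub_le (hΓ.continuous hp) (yosida R n) (z : X) (A z) t.2
    fun s hs hst => ?_
  set E := expSemigroup (yosida R n) s
  have hE : ∀ x, p (E x) ≤ p x := seminorm_yosida_semigroup_le hA hΓ hR hp n hs
  have e : E (yosida R n (z : X)) - A z = E (yosida R n (z : X) - A z) +
      (E (A z - w) + ((E w - w) + (w - A z))) := by
    simp only [map_sub]; abel
  have h2 := map_add_le_add p (E (yosida R n (z : X) - A z))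
    (E (A z - w) + ((E w - w) + (w - A z)))
  have h3 := map_add_le_add p (E (A z - w)) ((E w - w) + (w - A z))
  have h4 := map_add_le_add p (E w - w) (w - A z)
  have h5 := hE (yosida R n (z : X) - A z)
  have h6 := hE (A z - w)
  have h7 := seminorm_yosida_semigroup_sub_le hA hΓ hR hp n hs w
  have h8 : p (A w) * s ≤ p (A w) * t := by gcongr
  rw [map_sub_rev p (w : X)] at h4
  rw [e]
  linarith

/-- The semigroup law and contractivity reduce continuity at `s` to small increments from time 0,
where elements of `D(A)` have Lipschitz orbits. -/
theorem limit_continuous (hA : IsDissipative Γ A) (hΓ : IsNorming Γ) (hd : SeminormDense Γ A)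
    (hR : ∀ n : ℕ, IsResolventAt A (n + 1) (R n))
    (hT : ∀ (t : ℝ≥0) (x : X),
      SeminormTendsto Γ (fun n => expSemigroup (yosida R n) t x) (T t x))
    {p : Seminorm 𝕜 X} (hp : p ∈ Γ) (s : ℝ≥0) (x : X) :
    Tendsto (fun t => p (T t x - T s x)) (𝓝 s) (𝓝 0) := by
  have hle := limit_seminorm_le hA hΓ hR hT hp
  have key : ∀ (z : A.domain) (t s : ℝ≥0), p (T t x - T s x) ≤
      2 * p (x - z) + p (A z) * dist t s := by
    intro z
    have h1 : ∀ t s : ℝ≥0, s ≤ t → p (T t x - T s x) ≤ 2 * p (x - z) + p (A z) * dist t s := by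
      intro t s hst
      obtain ⟨d, rfl⟩ := exists_add_of_le hst
      have hdist : dist (s + d) s = (d : ℝ) := by
        rw [NNReal.dist_eq]; simp
      rw [limit_add hA hΓ hR hT, ← map_sub, hdist]
      refine (hle s _).trans ?_
      have e : T d x - x = T d (x - z) + ((T d (z : X) - z) + (z - x)) := by
        rw [map_sub]; abel
      have h2 := map_add_le_add p (T d (x - z)) ((T d (z : X) - z) + (z - x))
      have h3 := map_add_le_add p (T d (z : X) - z) (z - x)
      have h4 := hle d (x - z)
      have h5 := limit_sub_le hA hΓ hR hT hp d z
      rw [map_sub_rev p (z : X) x] at h3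
      rw [e]
      linarith
    intro t s
    rcases le_total s t with h | h
    · exact h1 t s h
    · rw [map_sub_rev, dist_comm]
      exact h1 s t h
  refine tendsto_order.2 ⟨fun a ha => Eventually.of_forall fun n => ha.trans_le
    (apply_nonneg _ _), fun ε hε => ?_⟩
  obtain ⟨z, hz⟩ := hd x p hp (ε / 4) (by positivity)
  have h0 : Tendsto (fun t : ℝ≥0 => p (A z) * dist t s) (𝓝 s) (𝓝 0) := by
    have : Continuous fun t : ℝ≥0 => p (A z) * dist t s := by fun_prop
    simpa using this.tendsto s
  filter_upwards [h0.eventually (gt_mem_nhds (half_pos hε))] with t ht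
  have := key z t s
  linarith

theorem limit_diffQuot (hA : IsDissipative Γ A) (hΓ : IsNorming Γ) (hd : SeminormDense Γ A)
    (hR : ∀ n : ℕ, IsResolventAt A (n + 1) (R n))
    (hT : ∀ (t : ℝ≥0) (x : X),
      SeminormTendsto Γ (fun n => expSemigroup (yosida R n) t x) (T t x))
    {p : Seminorm 𝕜 X} (hp : p ∈ Γ) (z : A.domain) :
    Tendsto (fun t => p (diffQuot T (z : X) t - A z)) (𝓝[>] 0) (𝓝 0) := by
  refine tendsto_order.2 ⟨fun a ha => Eventually.of_forall fun n => ha.trans_le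
    (apply_nonneg _ _), fun ε hε => ?_⟩
  obtain ⟨w, hw⟩ := hd (A z) p hp (ε / 4) (by positivity)
  have h0 : Tendsto (fun t : ℝ≥0 => p (A w) * t) (𝓝[>] 0) (𝓝 0) := by
    have : Continuous fun t : ℝ≥0 => p (A w) * (t : ℝ) := by fun_prop
    simpa using (this.tendsto 0).mono_left nhdsWithin_le_nhds
  filter_upwards [h0.eventually (gt_mem_nhds (half_pos hε)), self_mem_nhdsWithin] with t ht ht0
  have htpos : (0 : ℝ) < t := ht0
  have hne : ((t : ℝ) : 𝕜) ≠ 0 := by exact_mod_cast htpos.ne'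
  have e : diffQuot T (z : X) t - A z =
      (((t : ℝ) : 𝕜)⁻¹) • (T t (z : X) - z - ((t : ℝ) : 𝕜) • A z) := by
    rw [diffQuot, smul_sub _ (T t (z : X) - z), inv_smul_smul₀ hne]
  have h1 := limit_sub_sub_le hA hΓ hd hR hT hp t z w
  rw [e, map_smul_eq_mul, norm_inv, RCLike.norm_ofReal, abs_of_pos htpos]
  calc (t : ℝ)⁻¹ * p (T t (z : X) - z - ((t : ℝ) : 𝕜) • A z)
      ≤ (t : ℝ)⁻¹ * ((2 * p (A z - w) + p (A w) * t) * t) := by gcongr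
    _ = 2 * p (A z - w) + p (A w) * t := by field_simp
    _ < ε := by linarith

end Limit

end Yosida

/-! ### Integrals over `[0, 1]` as limits of Riemann sums. -/

section RiemannSums

variable {𝕜 X : Type*} [RCLike 𝕜] [NormedAddCommGroup X] [NormedSpace 𝕜 X]
  {P : Set (Seminorm 𝕜 X)}

/-- Hahn–Banach: every seminorm is attained at a given point by a functional it dominates. -/
theorem exists_dual_eq_seminorm (p : Seminorm 𝕜 X) (x : X) :
    ∃ φ : Module.Dual 𝕜 X, (∀ y, ‖φ y‖ ≤ p y) ∧ φ x = (p x : 𝕜) := by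
  by_cases hx : x = 0
  · exact ⟨0, fun y => by simp, by simp [hx]⟩
  obtain ⟨φ, h1, h2⟩ := Module.Dual.exists_extension_of_le_seminorm (𝕜 ∙ x)
    ((p x : 𝕜) • (LinearEquiv.coord 𝕜 X x hx : (𝕜 ∙ x) →ₗ[𝕜] 𝕜)) (p := p) (by
      intro y
      have hy := LinearEquiv.coord_apply_smul 𝕜 X x hx y
      conv_rhs => rw [← hy]
      rw [map_smul_eq_mul, LinearMap.smul_apply, norm_smul, RCLike.norm_ofReal,
        abs_of_nonneg (apply_nonneg p x), mul_comm]
      rfl)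
  refine ⟨φ, h2, ?_⟩
  have := h1 ⟨x, Submodule.mem_span_singleton_self x⟩
  simpa [LinearEquiv.coord_self, RCLike.real_smul_eq_coe_mul] using this

/-- `f : ℝ → X` is continuous with respect to the seminorm `p`. -/
def SeminormContinuous (p : Seminorm 𝕜 X) (f : ℝ → X) : Prop :=
  ∀ s, Tendsto (fun t => p (f t - f s)) (𝓝 s) (𝓝 0)

theorem SeminormContinuous.continuous_dist {p : Seminorm 𝕜 X} {f : ℝ → X}
    (hf : SeminormContinuous p f) : Continuous fun q : ℝ × ℝ => p (f q.1 - f q.2) := by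
  rw [continuous_iff_continuousAt]
  rintro ⟨s, t⟩
  rw [ContinuousAt, tendsto_iff_dist_tendsto_zero]
  have h0 := ((hf s).comp (continuous_fst.tendsto (s, t))).add
    ((hf t).comp (continuous_snd.tendsto (s, t)))
  rw [add_zero] at h0
  refine squeeze_zero (fun _ => dist_nonneg) (fun q => ?_) h0
  rw [Real.dist_eq]
  refine (abs_sub_map_le_sub p _ _).trans ?_
  rw [sub_sub_sub_comm]
  exact map_sub_le_add p _ _

theorem SeminormContinuous.exists_uniform {p : Seminorm 𝕜 X} {f : ℝ → X}
    (hf : SeminormContinuous p f) {ε : ℝ} (hε : 0 < ε) :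
    ∃ δ > 0, ∀ s ∈ Set.Icc (0 : ℝ) 1, ∀ t ∈ Set.Icc (0 : ℝ) 1, |s - t| < δ →
      p (f s - f t) < ε := by
  have huc := (isCompact_Icc.prod isCompact_Icc :
    IsCompact (Set.Icc (0 : ℝ) 1 ×ˢ Set.Icc (0 : ℝ) 1)).uniformContinuousOn_of_continuous
    hf.continuous_dist.continuousOn
  obtain ⟨δ, hδ, h⟩ := Metric.uniformContinuousOn_iff.1 huc ε hε
  refine ⟨δ, hδ, fun s hs t ht hst => ?_⟩
  have := h (s, t) ⟨hs, ht⟩ (t, t) ⟨ht, ht⟩ (by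
    simpa [Prod.dist_eq, Real.dist_eq, hδ] using hst)
  exact (le_abs_self _).trans_lt (by simpa [Real.dist_eq] using this)

theorem SeminormContinuous.continuous_dual {p : Seminorm 𝕜 X} {f : ℝ → X}
    (hf : SeminormContinuous p f) {φ : Module.Dual 𝕜 X} (hφ : ∀ x, ‖φ x‖ ≤ p x) :
    Continuous fun t => φ (f t) := by
  rw [continuous_iff_continuousAt]
  intro s
  rw [ContinuousAt, tendsto_iff_norm_sub_tendsto_zero]
  exact squeeze_zero (fun _ => norm_nonneg _) (fun t => by rw [← map_sub]; exact hφ _) (hf s)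

theorem norm_riemann_sum_sub_integral_le {g : ℝ → 𝕜} (hg : Continuous g) {ε : ℝ} {n : ℕ}
    (hn : 0 < n) (h : ∀ s ∈ Set.Icc (0 : ℝ) 1, ∀ t ∈ Set.Icc (0 : ℝ) 1,
      |s - t| ≤ (n : ℝ)⁻¹ → ‖g s - g t‖ ≤ ε) :
    ‖(n : 𝕜)⁻¹ * ∑ k ∈ Finset.range n, g (k / n) - ∫ t in (0 : ℝ)..1, g t‖ ≤ ε := by
  have hn' : (0 : ℝ) < n := by exact_mod_cast hn
  have hsum := intervalIntegral.sum_integral_adjacent_intervals (f := g)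
    (μ := MeasureTheory.volume) (a := fun k : ℕ => (k : ℝ) / n) (n := n)
    (fun k _ => hg.intervalIntegrable _ _)
  simp only [Nat.cast_zero, zero_div, div_self hn'.ne'] at hsum
  rw [← hsum, Finset.mul_sum, ← Finset.sum_sub_distrib]
  calc _ ≤ ∑ k ∈ Finset.range n, ε * (n : ℝ)⁻¹ := ?_
    _ = ε := by
      rw [Finset.sum_const, Finset.card_range, nsmul_eq_mul]
      field_simp
  refine norm_sum_le_of_le _ fun k hk => ?_
  have hkn : (k : ℝ) + 1 ≤ n := by exact_mod_cast Finset.mem_range.1 hk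
  have hlen : ((k + 1 : ℕ) : ℝ) / n - k / n = (n : ℝ)⁻¹ := by
    push_cast
    field_simp
    ring
  have hconst : ∫ _ in (k : ℝ) / n..((k + 1 : ℕ) : ℝ) / n, g (k / n) = (n : 𝕜)⁻¹ * g (k / n) := by
    rw [intervalIntegral.integral_const, hlen, RCLike.real_smul_eq_coe_mul]
    push_cast
    rfl
  have hle : (k : ℝ) / n ≤ ((k + 1 : ℕ) : ℝ) / n := by
    push_cast
    gcongr
    linarith
  rw [← hconst, ← intervalIntegral.integral_sub intervalIntegrable_const
    (hg.intervalIntegrable _ _)]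
  have := intervalIntegral.norm_integral_le_of_norm_le_const (C := ε)
    (f := fun t => g (k / n) - g t) (a := (k : ℝ) / n) (b := ((k + 1 : ℕ) : ℝ) / n) fun t ht => by
      rw [Set.uIoc_of_le hle] at ht
      have h0 : (0 : ℝ) ≤ k / n := by positivity
      have h1 : ((k + 1 : ℕ) : ℝ) / n ≤ 1 := by
        rw [div_le_one hn']
        exact_mod_cast hkn
      refine h _ ⟨h0, hle.trans h1⟩ _ ⟨h0.trans ht.1.le, ht.2.trans h1⟩ ?_
      rw [abs_sub_comm, abs_of_pos (sub_pos.2 ht.1), ← hlen]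
      linarith [ht.2]
  rwa [hlen, abs_of_pos (by positivity)] at this

/-- The Riemann sums of `f` on `[0, 1]` for the partition into `n + 1` intervals. -/
noncomputable def riemannSum (𝕜 : Type*) {X : Type*} [RCLike 𝕜] [NormedAddCommGroup X]
    [NormedSpace 𝕜 X] (f : ℝ → X) (n : ℕ) : X :=
  ((n + 1 : ℕ) : 𝕜)⁻¹ • ∑ k ∈ Finset.range (n + 1), f (k / (n + 1 : ℕ))

/-- The point is that `N` does not depend on `φ`: the modulus of continuity is that of `f` for `p`.
-/
theorem SeminormContinuous.riemannSum_sub_integral_le {p : Seminorm 𝕜 X} {f : ℝ → X}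
    (hf : SeminormContinuous p f) {ε : ℝ} (hε : 0 < ε) :
    ∃ N, ∀ n ≥ N, ∀ φ : Module.Dual 𝕜 X, (∀ x, ‖φ x‖ ≤ p x) →
      ‖φ (riemannSum 𝕜 f n) - ∫ t in (0 : ℝ)..1, φ (f t)‖ ≤ ε := by
  obtain ⟨δ, hδ, h⟩ := hf.exists_uniform hε
  obtain ⟨N, hN⟩ := exists_nat_one_div_lt hδ
  refine ⟨N, fun n hn φ hφ => ?_⟩
  have := norm_riemann_sum_sub_integral_le (hf.continuous_dual hφ) (ε := ε) n.succ_pos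
    fun s hs t ht hst => by
      rw [← map_sub]
      refine (hφ _).trans (h s hs t ht (hst.trans_lt (lt_of_le_of_lt ?_ hN))).le
      rw [← one_div]
      push_cast
      gcongr
  simpa [riemannSum, map_sum] using this

theorem norm_riemannSum_le {f : ℝ → X} {M : ℝ} (hM : ∀ t, ‖f t‖ ≤ M) (n : ℕ) :
    ‖riemannSum 𝕜 f n‖ ≤ M := by
  rw [riemannSum, norm_smul, norm_inv, RCLike.norm_natCast]
  have h := norm_sum_le_of_le (Finset.range (n + 1)) fun k _ => hM ((k : ℝ) / (n + 1 : ℕ))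
  rw [Finset.sum_const, Finset.card_range, nsmul_eq_mul] at h
  rw [inv_mul_eq_div, div_le_iff₀' (by positivity)]
  exact h

/-- A functional attaining `p` at the difference of two Riemann sums sees both of them near the same
scalar integral, so the sums are Cauchy for `p`. -/
theorem exists_riemannSum_limit (hc : BoundedlySeqComplete P) {f : ℝ → X}
    (hf : ∀ p ∈ P, SeminormContinuous p f) {M : ℝ} (hM : ∀ t, ‖f t‖ ≤ M) :
    ∃ z, SeminormTendsto P (riemannSum 𝕜 f) z := by
  refine hc _ ⟨M, norm_riemannSum_le hM⟩ fun p hp ε hε => ?_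
  obtain ⟨N, hN⟩ := (hf p hp).riemannSum_sub_integral_le (by positivity : 0 < ε / 3)
  refine ⟨N, fun n hn m hm => ?_⟩
  obtain ⟨φ, hφ, hφx⟩ := exists_dual_eq_seminorm p (riemannSum 𝕜 f n - riemannSum 𝕜 f m)
  have h1 := norm_sub_le_norm_sub_add_norm_sub (φ (riemannSum 𝕜 f n))
    (∫ t in (0 : ℝ)..1, φ (f t)) (φ (riemannSum 𝕜 f m))
  rw [← map_sub, hφx, RCLike.norm_ofReal, abs_of_nonneg (apply_nonneg _ _), norm_sub_rev
    (∫ t in (0 : ℝ)..1, φ (f t))] at h1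
  have := hN n hn φ hφ
  have := hN m hm φ hφ
  linarith

theorem dual_riemannSum_limit {f : ℝ → X} {z : X} (hz : SeminormTendsto P (riemannSum 𝕜 f) z)
    {p : Seminorm 𝕜 X} (hp : p ∈ P) (hf : SeminormContinuous p f) {φ : Module.Dual 𝕜 X}
    (hφ : ∀ x, ‖φ x‖ ≤ p x) : φ z = ∫ t in (0 : ℝ)..1, φ (f t) := by
  refine tendsto_nhds_unique (f := fun n => φ (riemannSum 𝕜 f n)) (l := atTop) ?_ ?_
  · rw [tendsto_iff_norm_sub_tendsto_zero]
    exact squeeze_zero (fun _ => norm_nonneg _) (fun t => by rw [← map_sub]; exact hφ _) (hz p hp)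
  · rw [Metric.tendsto_atTop]
    intro ε hε
    obtain ⟨N, hN⟩ := hf.riemannSum_sub_integral_le (half_pos hε)
    refine ⟨N, fun n hn => ?_⟩
    rw [dist_eq_norm]
    have := hN n hn φ hφ
    linarith

end RiemannSums

/-! ### Surjectivity of minus the generator of a stable semigroup. -/

section Range

variable {𝕜 X : Type*} [RCLike 𝕜] [NormedAddCommGroup X] [NormedSpace 𝕜 X]
  {P : Set (Seminorm 𝕜 X)}

/-- An exponentially stable semigroup, continuous for each seminorm in `P` and
sequentially continuous on norm bounded sequences. -/
structure IsStableSemigroup (P : Set (Seminorm 𝕜 X)) (S : OperatorFamily 𝕜 X) : Prop where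
  map_zero : ∀ x, S 0 x = x
  map_add : ∀ (t s : ℝ≥0) (x : X), S (t + s) x = S t (S s x)
  norm_le : ∀ (t : ℝ≥0) (x : X), ‖S t x‖ ≤ Real.exp (-t) * ‖x‖
  continuous : ∀ p ∈ P, ∀ (x : X) (s : ℝ≥0), Tendsto (fun t => p (S t x - S s x)) (𝓝 s) (𝓝 0)
  tendsto_map : ∀ (t : ℝ≥0) (u : ℕ → X) (x : X), (∃ C, ∀ n, ‖u n‖ ≤ C) →
    SeminormTendsto P u x → SeminormTendsto P (fun n => S t (u n)) (S t x)

variable {S : OperatorFamily 𝕜 X}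

theorem IsStableSemigroup.norm_le_norm (hS : IsStableSemigroup P S) (t : ℝ≥0) (x : X) :
    ‖S t x‖ ≤ ‖x‖ :=
  (hS.norm_le t x).trans (mul_le_of_le_one_left (norm_nonneg _)
    (Real.exp_le_one_iff.2 (neg_nonpos.2 t.2)))

theorem IsStableSemigroup.seminormContinuous (hS : IsStableSemigroup P S) {p : Seminorm 𝕜 X}
    (hp : p ∈ P) (x : X) : SeminormContinuous p fun t => S t.toNNReal x := fun s =>
  (hS.continuous p hp x s.toNNReal).comp (continuous_real_toNNReal.tendsto s)

/-- For `z = ∫ S(t) y` over `[0, 1]`, the difference `S(h) z - z` is close to `h (S(1) y - y)`. -/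
theorem IsStableSemigroup.seminorm_sub_sub_le (hS : IsStableSemigroup P S) {y z : X}
    (hz : SeminormTendsto P (riemannSum 𝕜 fun t => S t.toNNReal y) z)
    {p : Seminorm 𝕜 X} (hp : p ∈ P) {h : ℝ≥0} {C : ℝ}
    (h0 : ∀ t ≤ h, p (S t y - y) ≤ C) (h1 : ∀ t ≤ h, p (S (1 + t) y - S 1 y) ≤ C) :
    p (S h z - z - ((h : ℝ) : 𝕜) • (S 1 y - y)) ≤ 2 * C * h := by
  set f : ℝ → X := fun t => S t.toNNReal y with hfdef
  have hf : SeminormContinuous p f := hS.seminormContinuous hp y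
  have hfh : SeminormContinuous p fun t => f (t + h) := fun s =>
    (hf (s + h)).comp ((continuous_add_const (h : ℝ)).tendsto s)
  have hzh : SeminormTendsto P (riemannSum 𝕜 fun t => f (t + h)) (S h z) := by
    have := hS.tendsto_map h _ z ⟨‖y‖, norm_riemannSum_le fun t => hS.norm_le_norm _ y⟩ hz
    convert! this using 2 with n
    rw [riemannSum, riemannSum, map_smul, map_sum]
    congr 1
    refine Finset.sum_congr rfl fun k _ => ?_
    have hk : (0 : ℝ) ≤ k / (n + 1 : ℕ) := by positivity
    simp only [hfdef]
    rw [Real.toNNReal_add hk h.coe_nonneg, Real.toNNReal_coe, add_comm, hS.map_add]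
  obtain ⟨φ, hφ, hφx⟩ := exists_dual_eq_seminorm p (S h z - z - ((h : ℝ) : 𝕜) • (S 1 y - y))
  have hφc : Continuous fun t => φ (f t) := hf.continuous_dual hφ
  have hint : ∀ a b : ℝ, IntervalIntegrable (fun t => φ (f t)) MeasureTheory.volume a b :=
    fun a b => hφc.intervalIntegrable a b
  have e1 : φ (S h z) = ∫ t in (h : ℝ)..1 + h, φ (f t) := by
    rw [dual_riemannSum_limit hzh hp hfh hφ,
      intervalIntegral.integral_comp_add_right (fun t => φ (f t)), zero_add]
  have e2 : φ z = ∫ t in (0 : ℝ)..1, φ (f t) := dual_riemannSum_limit hz hp hf hφ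
  have hsub : ∀ (a : ℝ) (w : X), ∫ t in a..a + h, φ (f t - w) =
      (∫ t in a..a + h, φ (f t)) - ((h : ℝ) : 𝕜) * φ w := by
    intro a w
    simp only [map_sub]
    rw [intervalIntegral.integral_sub (hint _ _) intervalIntegrable_const,
      intervalIntegral.integral_const, add_sub_cancel_left, RCLike.real_smul_eq_coe_mul]
  have e3 : φ (S h z - z - ((h : ℝ) : 𝕜) • (S 1 y - y)) =
      (∫ t in (1 : ℝ)..1 + h, φ (f t - S 1 y)) - ∫ t in (0 : ℝ)..0 + h, φ (f t - y) := by
    rw [hsub, hsub, map_sub, map_sub, map_smul, map_sub, e1, e2, smul_eq_mul]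
    have a1 := intervalIntegral.integral_add_adjacent_intervals (hint 0 h) (hint h (1 + h))
    have a2 := intervalIntegral.integral_add_adjacent_intervals (hint 0 1) (hint 1 (1 + h))
    rw [zero_add]
    linear_combination a1 - a2
  have hh : (0 : ℝ) ≤ h := h.2
  have b1 : ‖∫ t in (1 : ℝ)..1 + h, φ (f t - S 1 y)‖ ≤ C * h := by
    have := intervalIntegral.norm_integral_le_of_norm_le_const (C := C)
      (f := fun t => φ (f t - S 1 y)) (a := (1 : ℝ)) (b := 1 + h) fun t ht => by
        rw [Set.uIoc_of_le (by linarith)] at ht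
        refine (hφ _).trans ?_
        have := h1 (t - 1).toNNReal (by
          rw [Real.toNNReal_le_iff_le_coe]; linarith [ht.2])
        rwa [← Real.toNNReal_one, ← Real.toNNReal_add zero_le_one (by linarith [ht.1]),
          add_sub_cancel, Real.toNNReal_one] at this
    rwa [add_sub_cancel_left, abs_of_nonneg hh] at this
  have b2 : ‖∫ t in (0 : ℝ)..0 + h, φ (f t - y)‖ ≤ C * h := by
    have := intervalIntegral.norm_integral_le_of_norm_le_const (C := C)
      (f := fun t => φ (f t - y)) (a := (0 : ℝ)) (b := 0 + h) fun t ht => by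
        rw [Set.uIoc_of_le (by linarith)] at ht
        refine (hφ _).trans (h0 _ ?_)
        rw [Real.toNNReal_le_iff_le_coe]
        linarith [ht.2]
    rwa [add_sub_cancel_left, abs_of_nonneg hh] at this
  have := congrArg norm (hφx.symm.trans e3)
  rw [RCLike.norm_ofReal, abs_of_nonneg (apply_nonneg _ _)] at this
  rw [this]
  refine (norm_sub_le _ _).trans ?_
  linarith

theorem IsStableSemigroup.summable (hS : IsStableSemigroup P S) (w : X) :
    Summable fun k : ℕ => ‖S k w‖ := by
  refine Summable.of_nonneg_of_le (fun _ => norm_nonneg _) (fun k => ?_)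
    (Real.summable_exp_neg_nat.mul_right ‖w‖)
  simpa using hS.norm_le k w

/-- `S` need not contract the seminorms in `P`, so each term tends to 0 only by `tendsto_map`; the
norm bound `e^{-k} C` dominates the series. -/
theorem IsStableSemigroup.tendsto_seminorm_tsum [CompleteSpace X] (hP : IsNorming P)
    (hS : IsStableSemigroup P S) {w : ℕ → X} {C : ℝ} (hC : ∀ n, ‖w n‖ ≤ C)
    (hw : SeminormTendsto P w 0) :
    SeminormTendsto P (fun n => ∑' k : ℕ, S k (w n)) 0 := by
  intro p hp
  have hle : ∀ n, p ((∑' k : ℕ, S k (w n)) - 0) ≤ ∑' k : ℕ, p (S k (w n)) := by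
    intro n
    have hs : Summable fun k : ℕ => p (S k (w n)) :=
      Summable.of_nonneg_of_le (fun _ => apply_nonneg _ _) (fun _ => hP.le_norm hp _)
        (hS.summable (w n))
    rw [sub_zero]
    refine le_of_tendsto
      ((hP.continuous hp).continuousAt.tendsto.comp (hS.summable (w n)).of_norm.hasSum)
      (Eventually.of_forall fun s => ?_)
    exact (Finset.le_sum_of_subadditive p (_root_.map_zero p).le (map_add_le_add p) _ _).trans
      (hs.sum_le_tsum s fun _ _ => apply_nonneg _ _)
  refine squeeze_zero (fun _ => apply_nonneg _ _) hle ?_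
  have := tendsto_tsum_of_dominated_convergence (𝓕 := atTop) (f := fun n (k : ℕ) => p (S k (w n)))
    (g := fun _ => 0) (Real.summable_exp_neg_nat.mul_right C) (fun k => ?_)
    (Eventually.of_forall fun n k => ?_)
  · simpa using this
  · have := hS.tendsto_map k w 0 ⟨C, hC⟩ hw p hp
    simpa using this
  · rw [Real.norm_of_nonneg (apply_nonneg _ _)]
    refine (hP.le_norm hp _).trans ((hS.norm_le k _).trans ?_)
    rw [NNReal.coe_natCast]
    gcongr
    exact hC n

/-- Minus the generator of a stable semigroup is surjective. -/
theorem IsStableSemigroup.exists_diffQuot_tendsto [CompleteSpace X] (hP : IsNorming P)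
    (hc : BoundedlySeqComplete P) (hS : IsStableSemigroup P S) (y : X) :
    ∃ x, (∃ C, ∀ h : ℝ≥0, ‖S h x - x‖ ≤ C * h) ∧
      ∀ p ∈ P, Tendsto (fun h => p (diffQuot S x h + y)) (𝓝[>] 0) (𝓝 0) := by
  obtain ⟨z, hz⟩ := exists_riemannSum_limit hc (fun p hp => hS.seminormContinuous hp y)
    fun t => hS.norm_le_norm t.toNNReal y
  set v := S 1 y - y with hv
  set x := ∑' k : ℕ, S k z with hx
  have hsum : ∀ w, Summable fun k : ℕ => S k w := fun w => (hS.summable w).of_norm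
  have hcomm : ∀ (t s : ℝ≥0) (w : X), S t (S s w) = S s (S t w) := fun t s w => by
    rw [← hS.map_add, add_comm, hS.map_add]
  -- The crude bound `C = 2‖y‖` makes the estimate uniform in `p`, hence valid in norm; it yields
  -- the boundedness of the difference quotients.
  have hzb : ∀ h : ℝ≥0, ‖S h z - z - ((h : ℝ) : 𝕜) • v‖ ≤ 2 * (2 * ‖y‖) * h := by
    intro h
    refine hP.norm_le fun p hp => hS.seminorm_sub_sub_le hz hp ?_ ?_ <;>
    · intro t _
      refine (hP.le_norm hp _).trans ((norm_sub_le _ _).trans ?_)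
      have h1 := hS.norm_le_norm t y
      have h2 := hS.norm_le_norm 1 y
      have h3 := hS.norm_le_norm (1 + t) y
      linarith
  have htel : ∑' k : ℕ, S k v = -y := by
    have h2 := (hsum v).hasSum.tendsto_sum_nat
    refine tendsto_nhds_unique h2 ?_
    have h3 : ∀ n : ℕ, ∑ k ∈ Finset.range n, S k v = S n y - y := by
      intro n
      have := Finset.sum_range_sub (fun k : ℕ => S k y) n
      rw [Nat.cast_zero, hS.map_zero] at this
      rw [← this]
      refine Finset.sum_congr rfl fun k _ => ?_
      rw [hv, map_sub, Nat.cast_succ, hS.map_add]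
    simp only [h3]
    simpa using (hsum y).tendsto_atTop_zero.sub_const y
  have hSx : ∀ h : ℝ≥0, S h x - x = ∑' k : ℕ, S k (S h z - z) := by
    intro h
    rw [hx, (S h).map_tsum (hsum z), ← Summable.tsum_sub ((hsum z).mapL (S h)) (hsum z)]
    refine tsum_congr fun k => ?_
    rw [map_sub, hcomm]
  have hE := Real.summable_exp_neg_nat
  refine ⟨x, ⟨(∑' k : ℕ, Real.exp (-k)) * (4 * ‖y‖ + ‖v‖), fun h => ?_⟩, fun p hp => ?_⟩
  · have hzh : ‖S h z - z‖ ≤ (4 * ‖y‖ + ‖v‖) * h := by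
      have h1 := norm_add_le (S h z - z - ((h : ℝ) : 𝕜) • v) (((h : ℝ) : 𝕜) • v)
      rw [sub_add_cancel, norm_smul, RCLike.norm_ofReal, NNReal.abs_eq] at h1
      have h2 := hzb h
      linarith
    rw [hSx, mul_assoc, ← _root_.tsum_mul_right]
    refine tsum_of_norm_bounded (hE.mul_right _).hasSum fun k => (hS.norm_le k _).trans ?_
    rw [NNReal.coe_natCast]
    gcongr
  -- The operators are only known to be continuous along norm bounded sequences, so `h → 0+` is
  -- tested along sequences.
  · rw [tendsto_iff_seq_tendsto]
    intro t ht
    let w : ℕ → X := fun n => if t n = 0 then 0 else diffQuot S z (t n) - v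
    have hw_eq : ∀ n, t n ≠ 0 →
        w n = (((t n : ℝ) : 𝕜)⁻¹) • (S (t n) z - z - ((t n : ℝ) : 𝕜) • v) := by
      intro n hn
      have hne : ((t n : ℝ) : 𝕜) ≠ 0 := by exact_mod_cast hn
      simp only [w, if_neg hn, diffQuot]
      rw [smul_sub _ (S (t n) z - z), inv_smul_smul₀ hne]
    have hwb : ∀ n, ‖w n‖ ≤ 4 * ‖y‖ := by
      intro n
      by_cases hn : t n = 0
      · simp only [w, if_pos hn, norm_zero]
        positivity
      · have hpos : (0 : ℝ) < t n := by exact_mod_cast pos_iff_ne_zero.2 hn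
        rw [hw_eq n hn, norm_smul, norm_inv, RCLike.norm_ofReal, abs_of_pos hpos,
          inv_mul_eq_div, div_le_iff₀ hpos]
        linarith [hzb (t n)]
    have ht0 : Tendsto t atTop (𝓝 0) := ht.mono_right nhdsWithin_le_nhds
    have htpos : ∀ᶠ n in atTop, 0 < t n := (tendsto_nhdsWithin_iff.1 ht).2
    have hw0 : SeminormTendsto P w 0 := by
      intro q hq
      refine tendsto_order.2 ⟨fun a ha => Eventually.of_forall fun n => ha.trans_le
        (apply_nonneg _ _), fun ε hε => ?_⟩
      have c0 := hS.continuous q hq y 0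
      have c1 : Tendsto (fun s => q (S (1 + s) y - S 1 y)) (𝓝 0) (𝓝 0) := by
        have := (continuous_const_add (1 : ℝ≥0)).tendsto 0
        rw [add_zero] at this
        exact (hS.continuous q hq y 1).comp this
      rw [hS.map_zero] at c0
      have c2 := (c0.eventually (gt_mem_nhds (by positivity : 0 < ε / 3))).and
        (c1.eventually (gt_mem_nhds (by positivity : 0 < ε / 3)))
      obtain ⟨δ, hδ, hball⟩ := Metric.eventually_nhds_iff.1 c2
      have c3 : ∀ᶠ n in atTop, dist (t n) 0 < δ := ht0.eventually (Metric.ball_mem_nhds 0 hδ)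
      filter_upwards [htpos, c3] with n hn hnδ
      have hlt : ∀ s ≤ t n, dist s 0 < δ := fun s hs => by
        refine lt_of_le_of_lt ?_ hnδ
        simpa [NNReal.dist_eq] using hs
      have h1 := hS.seminorm_sub_sub_le hz hq (h := t n) (C := ε / 3)
        (fun s hs => (hball (hlt s hs)).1.le) (fun s hs => (hball (hlt s hs)).2.le)
      have hpos : (0 : ℝ) < t n := by exact_mod_cast hn
      rw [sub_zero, hw_eq n hn.ne', map_smul_eq_mul, norm_inv, RCLike.norm_ofReal,
        abs_of_pos hpos, inv_mul_eq_div, div_lt_iff₀ hpos]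
      refine h1.trans_lt ?_
      gcongr
      linarith
    have hlim := hS.tendsto_seminorm_tsum hP hwb hw0 p hp
    refine hlim.congr' ?_
    filter_upwards [htpos] with n hn
    have hne : t n ≠ 0 := hn.ne'
    simp only [Function.comp_apply, sub_zero, w, if_neg hne]
    congr 1
    -- With `∑ S(k) v = -y`, this gives `diffQuot S x (t n) + y = ∑ S(k) (w n)`.
    have : diffQuot S x (t n) = ∑' k : ℕ, S k (diffQuot S z (t n)) := by
      rw [diffQuot, hSx, ← (hsum _).tsum_const_smul]
      simp only [diffQuot, map_smul]
    rw [this, ← neg_neg y, ← htel, ← sub_eq_add_neg, ← Summable.tsum_sub (hsum _) (hsum _)]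
    simp only [map_sub]

end Range

/-! ### Passing between `τ`, `γ` and `υ` on norm bounded sequences. -/

section Convergence

theorem withSeminorms_tendsto_iff {𝕜 E ι κ : Type*} [NormedField 𝕜] [AddCommGroup E] [Module 𝕜 E]
    [TopologicalSpace E] {q : SeminormFamily 𝕜 E κ} (hq : WithSeminorms q)
    {v : ι → E} {l : Filter ι} {x : E} :
    Tendsto v l (𝓝 x) ↔ ∀ i, Tendsto (fun j => q i (v j - x)) l (𝓝 0) := by
  rw [hq.tendsto_nhds]
  refine forall_congr' fun i => ⟨fun h => tendsto_order.2 ⟨fun a ha =>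
    Eventually.of_forall fun n => ha.trans_le (apply_nonneg _ _), h⟩, fun h ε hε =>
      h.eventually (gt_mem_nhds hε)⟩

variable {𝕜 X : Type*} [RCLike 𝕜] [NormedAddCommGroup X] [NormedSpace 𝕜 X]
  {P Γ : Set (Seminorm 𝕜 X)} {τ υ : TopologicalSpace X}

theorem IsGeneratingSystem.tendsto_iff {ι : Type*} (hP : IsGeneratingSystem 𝕜 P τ) {v : ι → X}
    {l : Filter ι} {x : X} :
    Tendsto v l (@nhds X τ x) ↔ ∀ p ∈ P, Tendsto (fun j => p (v j - x)) l (𝓝 0) := by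
  rw [@withSeminorms_tendsto_iff _ _ _ _ _ _ _ τ _ hP.withSeminorms, Subtype.forall]

theorem IsGeneratingSystem.isVectorTopology (hP : IsGeneratingSystem 𝕜 P τ) :
    IsVectorTopology 𝕜 τ :=
  ⟨@WithSeminorms.topologicalAddGroup 𝕜 X P _ _ _ τ _ hP.withSeminorms,
    @WithSeminorms.continuousSMul 𝕜 X P _ _ _ τ _ hP.withSeminorms⟩

/-- Adjoining the limit to the range keeps it bounded, and convergence can be read in the induced
topology of that set. -/
theorem AgreeOnBounded.tendsto {σ τ : TopologicalSpace X} (h : AgreeOnBounded σ τ) {ι : Type*}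
    {v : ι → X} {l : Filter ι} {x : X} (hv : Bornology.IsBounded (Set.range v))
    (hx : Tendsto v l (@nhds X τ x)) : Tendsto v l (@nhds X σ x) := by
  have hB : Bornology.IsBounded (insert x (Set.range v)) := hv.insert x
  have hi := h _ hB
  let v' : ι → (insert x (Set.range v) : Set X) := fun i => ⟨v i, Or.inr ⟨i, rfl⟩⟩
  have key : ∀ ρ : TopologicalSpace X, Tendsto v l (@nhds X ρ x) ↔
      Tendsto v' l (@nhds _ (TopologicalSpace.induced Subtype.val ρ) ⟨x, Or.inl rfl⟩) := by
    intro ρ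
    rw [@nhds_induced _ _ ρ, tendsto_comap_iff]
    rfl
  rw [key, hi, ← key]
  exact hx

theorem isBounded_range_iff {ι : Type*} {v : ι → X} :
    Bornology.IsBounded (Set.range v) ↔ ∃ C, ∀ i, ‖v i‖ ≤ C := by
  simp [isBounded_iff_forall_norm_le]

theorem IsSaksSpace.agreeOnBounded_mixedTopology (hτ : IsSaksSpace 𝕜 τ) :
    AgreeOnBounded (mixedTopology 𝕜 τ) τ := by
  obtain ⟨P, hP, -⟩ := hτ.exists_norming
  exact (isLeast_mixedTopology hP.isVectorTopology hτ.coarser).1.2.1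

theorem IsSaksSpace.mixedTopology_le (hτ : IsSaksSpace 𝕜 τ) : mixedTopology 𝕜 τ ≤ τ := by
  obtain ⟨P, hP, -⟩ := hτ.exists_norming
  exact (isLeast_mixedTopology hP.isVectorTopology hτ.coarser).1.2.2.1

/-- The differences of a bounded sequence are bounded, so being `τ`-Cauchy makes it `γ`-Cauchy. -/
theorem IsSeqCompleteSaksSpace.boundedlySeqComplete (hτ : IsSeqCompleteSaksSpace 𝕜 τ)
    (hP : IsGeneratingSystem 𝕜 P τ) : BoundedlySeqComplete P := by
  rintro u ⟨C, hC⟩ hu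
  have h1 : Tendsto (fun k : ℕ × ℕ => u k.1 - u k.2) atTop (@nhds X τ 0) := by
    refine hP.tendsto_iff.2 fun p hp => tendsto_order.2 ⟨fun a ha =>
      Eventually.of_forall fun n => ha.trans_le (apply_nonneg _ _), fun ε hε => ?_⟩
    rw [eventually_atTop_prod_self']
    simpa only [sub_zero] using hu p hp ε hε
  have hb : Bornology.IsBounded (Set.range fun k : ℕ × ℕ => u k.1 - u k.2) :=
    isBounded_range_iff.2 ⟨C + C, fun k => (norm_sub_le _ _).trans (add_le_add (hC _) (hC _))⟩
  obtain ⟨x, hx⟩ := hτ.seqComplete u (hτ.agreeOnBounded_mixedTopology.tendsto hb h1)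
  exact ⟨x, hP.tendsto_iff.1 (hx.mono_right (nhds_mono hτ.mixedTopology_le))⟩

/-- Norm bounded `τ`-convergent sequences converge in `υ`, to the same limit. -/
theorem IsSaksSpace.tendsto_of_bounded (hτ : IsSaksSpace 𝕜 τ) (hυτ : υ ≤ τ)
    (hseq : ∀ (u : ℕ → X) (x : X), Tendsto u atTop (@nhds X (mixedTopology 𝕜 τ) x) →
      ∃ y : X, Tendsto u atTop (@nhds X υ y))
    {u : ℕ → X} {x : X} (hu : Bornology.IsBounded (Set.range u))
    (hx : Tendsto u atTop (@nhds X τ x)) : Tendsto u atTop (@nhds X υ x) := by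
  obtain ⟨y, hy⟩ := hseq u x (hτ.agreeOnBounded_mixedTopology.tendsto hu hx)
  have : x = y := @tendsto_nhds_unique X ℕ τ hτ.hausdorff_lc.t2 _ _ _ _ _ hx
    (hy.mono_right (nhds_mono hυτ))
  rwa [this]

theorem BoundedlySeqComplete.of_finer (hc : BoundedlySeqComplete P)
    (hP : IsGeneratingSystem 𝕜 P τ) (hΓ : IsGeneratingSystem 𝕜 Γ υ) (hυτ : υ ≤ τ)
    (hb : ∀ (u : ℕ → X) (x : X), (∃ C, ∀ n, ‖u n‖ ≤ C) → SeminormTendsto P u x →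
      SeminormTendsto Γ u x) : BoundedlySeqComplete Γ := by
  rintro u hC hu
  have h1 : Tendsto (fun k : ℕ × ℕ => u k.1 - u k.2) atTop (@nhds X υ 0) := by
    refine hΓ.tendsto_iff.2 fun p hp => tendsto_order.2 ⟨fun a ha =>
      Eventually.of_forall fun n => ha.trans_le (apply_nonneg _ _), fun ε hε => ?_⟩
    rw [eventually_atTop_prod_self']
    simpa only [sub_zero] using hu p hp ε hε
  have h2 := hP.tendsto_iff.1 (h1.mono_right (nhds_mono hυτ))
  obtain ⟨x, hx⟩ := hc u hC fun p hp ε hε => by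
    have := (h2 p hp).eventually (gt_mem_nhds hε)
    rw [eventually_atTop_prod_self'] at this
    simpa only [sub_zero] using this
  exact ⟨x, hb u x hC hx⟩

end Convergence

/-! ### The two implications. -/

section Generation

variable {𝕜 X : Type*} [RCLike 𝕜] [NormedAddCommGroup X] [NormedSpace 𝕜 X]
  {P Γ : Set (Seminorm 𝕜 X)} {τ υ : TopologicalSpace X} {A : X →ₗ.[𝕜] X}

theorem IsBiContinuousSemigroup.isStableSemigroup {T : OperatorFamily 𝕜 X}
    (hT : IsBiContinuousSemigroup τ T) (hTc : IsContractive T) (hP : IsGeneratingSystem 𝕜 P τ) :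
    IsStableSemigroup P fun t => ((Real.exp (-t) : ℝ) : 𝕜) • T t where
  map_zero x := by simp [hT.map_zero]
  map_add t s x := by
    simp only [smul_apply, map_smul, hT.map_add, smul_smul]
    rw [NNReal.coe_add, neg_add, Real.exp_add]
    push_cast
    rw [mul_comm]
  norm_le t x := by
    rw [smul_apply, norm_smul, RCLike.norm_ofReal, Real.abs_exp]
    gcongr
    simpa using (T t).le_of_opNorm_le (hTc t) x
  continuous p hp x s := by
    have h1 := hP.tendsto_iff.1 (@Continuous.tendsto _ _ _ τ _ (hT.strongly_continuous x) s) p hp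
    have he : Continuous fun t : ℝ≥0 => Real.exp (-t) := by fun_prop
    have h2 : Tendsto (fun t : ℝ≥0 => |Real.exp (-t) - Real.exp (-s)|) (𝓝 s) (𝓝 0) := by
      have : Continuous fun t : ℝ≥0 => |Real.exp (-t) - Real.exp (-s)| := by fun_prop
      simpa using this.tendsto s
    have h3 := ((he.tendsto s).mul h1).add (h2.mul_const (p (T s x)))
    rw [mul_zero, zero_mul, add_zero] at h3
    refine squeeze_zero (fun _ => apply_nonneg _ _) (fun t => ?_) h3
    have e : (((Real.exp (-t) : ℝ) : 𝕜) • T t) x - (((Real.exp (-s) : ℝ) : 𝕜) • T s) x =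
        ((Real.exp (-t) : ℝ) : 𝕜) • (T t x - T s x) +
          ((Real.exp (-t) - Real.exp (-s) : ℝ) : 𝕜) • T s x := by
      simp only [smul_apply]
      push_cast
      module
    rw [e]
    refine (map_add_le_add p _ _).trans ?_
    simp only [map_smul_eq_mul, RCLike.norm_ofReal, Real.abs_exp, le_refl]
  tendsto_map t u x hu hx p hp := by
    have h1 : Tendsto (fun n => T t (u n - x)) atTop (@nhds X τ 0) := fun U hU =>
      (hT.locally_bi_equicontinuous u x (isBounded_range_iff.2 hu) (hP.tendsto_iff.2 hx) t U
        hU).mono fun n hn => hn t le_rfl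
    have h2 := (hP.tendsto_iff.1 h1 p hp).const_mul (Real.exp (-t))
    rw [mul_zero] at h2
    refine h2.congr fun n => ?_
    rw [sub_zero, ← map_sub, smul_apply, map_smul_eq_mul, RCLike.norm_ofReal, Real.abs_exp]

theorem surjectiveAt_one_of_isGenerator [CompleteSpace X] (hP : IsGeneratingSystem 𝕜 P τ)
    (hPn : IsNorming P) (hc : BoundedlySeqComplete P) {T : OperatorFamily 𝕜 X}
    (hT : IsBiContinuousSemigroup τ T) (hTc : IsContractive T) (hA : IsGenerator τ T A) :
    SurjectiveAt A 1 := by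
  have hS := hT.isStableSemigroup hTc hP
  set S : OperatorFamily 𝕜 X := fun t => ((Real.exp (-t) : ℝ) : 𝕜) • T t with hSdef
  intro y
  obtain ⟨x, ⟨C, hC⟩, hx⟩ := hS.exists_diffQuot_tendsto hPn hc y
  -- Undoing the rescaling turns the limit `-y` for `S` into `x - y` for `T`.
  have hTS : ∀ h, T h x - x = ((Real.exp h : ℝ) : 𝕜) • (S h x - x) +
      ((Real.exp h - 1 : ℝ) : 𝕜) • x := by
    intro h
    have h1 : ((Real.exp h : ℝ) : 𝕜) * ((Real.exp (-h) : ℝ) : 𝕜) = 1 := by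
      rw [← RCLike.ofReal_mul, ← Real.exp_add]; simp
    simp only [hSdef, smul_apply]
    rw [smul_sub, smul_smul, h1]
    push_cast
    module
  have hlim : Tendsto (diffQuot T x) (𝓝[>] 0) (@nhds X τ (x - y)) := by
    refine hP.tendsto_iff.2 fun p hp => ?_
    have c1 : Tendsto (fun h : ℝ≥0 => Real.exp h) (𝓝[>] 0) (𝓝 1) := by
      have : Continuous fun h : ℝ≥0 => Real.exp h := by fun_prop
      simpa using (this.tendsto 0).mono_left nhdsWithin_le_nhds
    have c2 : Tendsto (fun h : ℝ≥0 => (h : ℝ)) (𝓝[>] 0) (𝓝 0) := by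
      have : Continuous fun h : ℝ≥0 => (h : ℝ) := by fun_prop
      simpa using (this.tendsto 0).mono_left nhdsWithin_le_nhds
    have c3 := ((c1.mul (hx p hp)).add ((c1.sub_const 1).abs.mul_const (p y))).add
      (c2.mul_const (p x))
    simp only [mul_zero, sub_self, abs_zero, zero_mul, add_zero] at c3
    refine squeeze_zero' (Eventually.of_forall fun _ => apply_nonneg _ _) ?_ c3
    filter_upwards [self_mem_nhdsWithin, c2.eventually (gt_mem_nhds one_pos)] with h h0 h1
    have hpos : (0 : ℝ) < h := h0
    have hne : ((h : ℝ) : 𝕜) ≠ 0 := by exact_mod_cast hpos.ne'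
    have e : diffQuot T x h - (x - y) = (((Real.exp h : ℝ) : 𝕜) • (diffQuot S x h + y) -
        ((Real.exp h - 1 : ℝ) : 𝕜) • y) + (((Real.exp h - 1) / h - 1 : ℝ) : 𝕜) • x := by
      rw [diffQuot, diffQuot, hTS]
      push_cast
      module
    have hb : |(Real.exp h - 1) / h - 1| ≤ h := by
      have h2 := Real.abs_exp_sub_one_sub_id_le (x := h) (by rw [abs_of_pos hpos]; exact h1.le)
      rw [div_sub_one hpos.ne', abs_div, abs_of_pos hpos, div_le_iff₀ hpos, ← sq]
      exact h2
    rw [e]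
    refine (map_add_le_add p _ _).trans (add_le_add ((map_sub_le_add p _ _).trans ?_) ?_)
    · simp only [map_smul_eq_mul, RCLike.norm_ofReal, Real.abs_exp, le_refl]
    · rw [map_smul_eq_mul, RCLike.norm_ofReal]
      gcongr
  have hmem : x ∈ A.domain := by
    -- From `e^h ≤ e` and `|e^h - 1| ≤ 2h` on `(0, 1]`.
    refine (hA.mem_domain_iff x).2 ⟨⟨_, hlim⟩, Real.exp 1 * C + 2 * ‖x‖, fun h h0 h1 => ?_⟩
    have hpos : (0 : ℝ) < h := h0
    have hle : (h : ℝ) ≤ 1 := h1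
    rw [div_le_iff₀ hpos, hTS]
    refine (norm_add_le _ _).trans ?_
    rw [norm_smul, norm_smul, RCLike.norm_ofReal, RCLike.norm_ofReal, Real.abs_exp, add_mul,
      mul_assoc, mul_right_comm]
    have h2 := Real.abs_exp_sub_one_le (x := h) (by rw [abs_of_pos hpos]; exact hle)
    rw [abs_of_pos hpos] at h2
    gcongr
    exact hC h
  refine ⟨⟨x, hmem⟩, ?_⟩
  have hAx : A ⟨x, hmem⟩ = x - y := by
    refine sub_eq_zero.1 (hPn.eq_zero fun p hp => ?_)
    have h1 := hP.tendsto_iff.1 (hA.tendsto_apply ⟨x, hmem⟩) p hp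
    have h2 := h1.add (hP.tendsto_iff.1 hlim p hp)
    rw [add_zero] at h2
    refine ge_of_tendsto' h2 fun h => ?_
    rw [map_sub_rev p (diffQuot T x h)]
    refine le_trans (le_of_eq ?_) (map_add_le_add p _ _)
    rw [sub_add_sub_cancel]
  simp only [hAx, RCLike.ofReal_one, one_smul]
  abel

theorem generates_of_surjectiveAt [CompleteSpace X] (hP : IsGeneratingSystem 𝕜 P τ)
    (hΓ : IsGeneratingSystem 𝕜 Γ υ) (hΓn : IsNorming Γ) (hυτ : υ ≤ τ)
    (hc : BoundedlySeqComplete Γ)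
    (hb : ∀ (u : ℕ → X) (x : X), (∃ C, ∀ n, ‖u n‖ ≤ C) → SeminormTendsto P u x →
      SeminormTendsto Γ u x)
    (hd : SeminormDense Γ A) (hA : IsDissipative Γ A) {r : ℝ} (hr : 0 < r)
    (hs : SurjectiveAt A r) : GeneratesBiContinuousContractionSemigroup τ A := by
  choose R hR using fun n : ℕ => hA.exists_resolvent hΓn (by positivity : (0 : ℝ) < n + 1)
    (hA.surjectiveAt hΓn hr hs (by positivity))
  obtain ⟨T, hT⟩ := exists_limit_semigroup hA hΓn hd hc hR
  have hle := fun p hp t x => limit_seminorm_le (p := p) hA hΓn hR hT hp t x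
  have hτυ : ∀ {ι : Type} {v : ι → X} {l : Filter ι} {x : X},
      (∀ p ∈ Γ, Tendsto (fun j => p (v j - x)) l (𝓝 0)) → Tendsto v l (@nhds X τ x) :=
    fun h => (hΓ.tendsto_iff.2 h).mono_right (nhds_mono hυτ)
  have hTc : IsContractive T := fun t =>
    (T t).opNorm_le_bound zero_le_one fun x => by
      rw [one_mul]
      exact hΓn.norm_le fun p hp => (hle p hp t x).trans (hΓn.le_norm hp x)
  have hbound : ∀ (z : A.domain) (t : ℝ≥0), ‖T t (z : X) - z‖ ≤ ‖A z‖ * t := fun z t =>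
    hΓn.norm_le fun p hp => (limit_sub_le hA hΓn hR hT hp t z).trans (by
      gcongr
      exact hΓn.le_norm hp _)
  refine ⟨T, ⟨fun x => ?_, limit_add hA hΓn hR hT, fun x => ?_, ⟨1, 0, le_rfl, fun t => ?_⟩,
    fun u x hu hx t₀ U hU => ?_⟩, hTc, fun x => ⟨fun hx => ?_, ?_⟩, fun z => ?_⟩
  · refine (hT 0 x).unique hΓn fun p _ => ?_
    simp
  · refine (@continuous_iff_continuousAt _ _ _ τ _).2 fun s => ?_
    exact hτυ fun p hp => limit_continuous hA hΓn hd hR hT hp s x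
  · simpa using hTc t
  · have hx' := hb u x (isBounded_range_iff.1 hu) (hP.tendsto_iff.1 hx)
    classical
    -- Choose a time violating uniformity whenever there is one, and 0 otherwise. Contractivity for
    -- each `p ∈ Γ` forces `T (t n) (u n - x) → 0` for any choice of times, so violations eventually
    -- stop.
    let t : ℕ → ℝ≥0 := fun n =>
      if h : ∃ t ≤ t₀, T t (u n - x) ∉ U then h.choose else 0
    have hlim : Tendsto (fun n => T (t n) (u n - x)) atTop (@nhds X τ 0) :=
      hτυ fun p hp => squeeze_zero (fun _ => apply_nonneg _ _)
        (fun n => by rw [sub_zero]; exact hle p hp _ _) (hx' p hp)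
    filter_upwards [hlim.eventually_mem hU] with n hn s hs
    by_contra hcon
    have h : ∃ t ≤ t₀, T t (u n - x) ∉ U := ⟨s, hs, hcon⟩
    simp only [t, dif_pos h] at hn
    exact h.choose_spec.2 hn
  · refine ⟨⟨A ⟨x, hx⟩, hτυ fun p hp => limit_diffQuot hA hΓn hd hR hT hp ⟨x, hx⟩⟩,
      ‖A ⟨x, hx⟩‖, fun t ht _ => ?_⟩
    rw [div_le_iff₀ (by exact_mod_cast ht)]
    exact hbound ⟨x, hx⟩ t
  · rintro ⟨⟨y, hy⟩, C, hC⟩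
    -- Maximality: `w ∈ D(A)` has the same image under `1` minus the generator as `x`, so it remains
    -- to show `x = w`.
    obtain ⟨w, hw⟩ := hA.surjectiveAt hΓn hr hs one_pos (x - y)
    simp only [RCLike.ofReal_one, one_smul] at hw
    -- A sequence in `(0, 1]`, where the quotients are norm bounded, so that their `τ`-convergence
    -- upgrades to every `p ∈ Γ`.
    let s : ℕ → ℝ≥0 := fun n => 1 / ((n : ℝ≥0) + 1)
    have hs0 : ∀ n, 0 < s n := fun n => by positivity
    have hs1 : ∀ n, s n ≤ 1 := fun n => by
      simp only [s]
      rw [div_le_one (by positivity)]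
      exact le_add_of_nonneg_left zero_le
    have hlim : Tendsto s atTop (𝓝[>] 0) := by
      refine tendsto_nhdsWithin_iff.2 ⟨?_, Eventually.of_forall hs0⟩
      exact NNReal.tendsto_coe.1 (by
        simpa [s] using tendsto_one_div_add_atTop_nhds_zero_nat (𝕜 := ℝ))
    have hqx : SeminormTendsto Γ (fun n => diffQuot T x (s n)) y := by
      refine hb _ y ⟨C, fun n => ?_⟩ (hP.tendsto_iff.1 (hy.comp hlim))
      have := hC (s n) (hs0 n) (hs1 n)
      rwa [diffQuot, norm_smul, norm_inv, RCLike.norm_ofReal, NNReal.abs_eq, inv_mul_eq_div]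
    have hqw : SeminormTendsto Γ (fun n => diffQuot T (w : X) (s n)) (A w) := fun p hp =>
      (limit_diffQuot hA hΓn hd hR hT hp w).comp hlim
    suffices x - w = 0 by
      rw [sub_eq_zero.1 this]
      exact w.2
    refine hΓn.eq_zero fun p hp => ?_
    have h0 := (hqx p hp).add (hqw p hp)
    rw [add_zero] at h0
    refine ge_of_tendsto' h0 fun n => ?_
    have hpos : (0 : ℝ) < s n := hs0 n
    have hne : ((s n : ℝ) : 𝕜) ≠ 0 := by exact_mod_cast hpos.ne'
    set d := x - (w : X) with hd_def
    have e1 : (diffQuot T x (s n) - y) - (diffQuot T (w : X) (s n) - A w) =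
        diffQuot T d (s n) - d := by
      have : y = x - w + A w := by
        rw [sub_add, hw]
        abel
      simp only [diffQuot, hd_def, map_sub]
      rw [this]
      module
    have h1 := map_sub_le_add p (diffQuot T x (s n) - y) (diffQuot T (w : X) (s n) - A w)
    rw [e1] at h1
    refine le_trans ?_ h1
    -- Here `d` would be an eigenvector for eigenvalue 1. Contractivity gives `(1 + s) p d ≤ p d + s
    -- p (diffQuot T d s - d)`, so `p d` is at most a quantity tending to 0.
    have e2 : T (s n) d - ((s n : ℝ) : 𝕜) • (diffQuot T d (s n) - d) =
        ((1 + s n : ℝ) : 𝕜) • d := by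
      rw [smul_sub, diffQuot, smul_inv_smul₀ hne]
      push_cast
      module
    have h2 := map_sub_le_add p (T (s n) d) (((s n : ℝ) : 𝕜) • (diffQuot T d (s n) - d))
    rw [e2, map_smul_eq_mul, map_smul_eq_mul, RCLike.norm_ofReal, RCLike.norm_ofReal,
      abs_of_pos hpos, abs_of_pos (by positivity)] at h2
    have h3 := hle p hp (s n) d
    have h4 : s n * p d ≤ s n * p (diffQuot T d (s n) - d) := by linarith
    exact le_of_mul_le_mul_left h4 hpos
  · exact hτυ fun p hp => limit_diffQuot hA hΓn hd hR hT hp z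

end Generation

end SaksSpace

theorem mainTheorem1 {𝕜 X : Type*} [RCLike 𝕜] [NormedAddCommGroup X] [NormedSpace 𝕜 X]
    [CompleteSpace X] (τ υ : TopologicalSpace X)
    (hτ : SaksSpace.IsSeqCompleteSaksSpace 𝕜 τ)
    (hυ : SaksSpace.IsHausdorffLocallyConvex 𝕜 υ)
    (hυτ : υ ≤ τ) (hυn : SaksSpace.normTopology X ≤ υ)
    (hseq : ∀ (u : ℕ → X) (x : X),
      Tendsto u atTop (@nhds X (SaksSpace.mixedTopology 𝕜 τ) x) →
        ∃ y : X, Tendsto u atTop (@nhds X υ y))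
    (Γ : Set (Seminorm 𝕜 X)) (hΓ : SaksSpace.IsGeneratingSystem 𝕜 Γ υ)
    (hΓn : SaksSpace.IsNorming Γ)
    (A : X →ₗ.[𝕜] X) (hAdense : SaksSpace.IsBiDenselyDefined τ A)
    (hAdiss : SaksSpace.IsDissipative Γ A) :
    SaksSpace.GeneratesBiContinuousContractionSemigroup τ A ↔
      ∃ r : ℝ, 0 < r ∧
        Function.Surjective (fun x : A.domain => (r : 𝕜) • (x : X) - A x) := by
  obtain ⟨P, hP, hPn⟩ := hτ.exists_norming
  have hc := hτ.boundedlySeqComplete hP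
  -- This transfer carries both completeness and density of `D(A)` from `P` to `Γ`.
  have hb : ∀ (u : ℕ → X) (x : X), (∃ C, ∀ n, ‖u n‖ ≤ C) → SaksSpace.SeminormTendsto P u x →
      SaksSpace.SeminormTendsto Γ u x := fun u x hC hx =>
    hΓ.tendsto_iff.1 (hτ.tendsto_of_bounded hυτ hseq (SaksSpace.isBounded_range_iff.2 hC)
      (hP.tendsto_iff.2 hx))
  constructor
  · rintro ⟨T, hT, hTc, hA⟩
    exact ⟨1, one_pos, SaksSpace.surjectiveAt_one_of_isGenerator hP hPn hc hT hTc hA⟩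
  · rintro ⟨r, hr, hs⟩
    refine SaksSpace.generates_of_surjectiveAt hP hΓ hΓn hυτ (hc.of_finer hP hΓ hυτ hb) hb
      (fun x p hp ε hε => ?_) hAdiss hr hs
    obtain ⟨u, hu, hub, hux⟩ := hAdense x
    have h1 := hb u x (SaksSpace.isBounded_range_iff.1 hub) (hP.tendsto_iff.1 hux) p hp
    obtain ⟨n, hn⟩ := (h1.eventually (gt_mem_nhds hε)).exists
    exact ⟨⟨u n, hu n⟩, by rwa [map_sub_rev]⟩
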